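/- Let $Q\ge 1$, let $p$ be the dimension, and let $q\in\{1,\dots,Q\}$. For $k\in\{0,\dots,Q\}$ ($k=0$ the target, $k\ge 1$ the sources) let $y^{(k)}=X^{(k)}\beta^{(k)}+\varepsilon^{(k)}$ with $X^{(k)}\in\mathbb R^{n_k\times p}$, fixed $\beta^{(k)}\in\mathbb R^p$ and $\beta^{(0)}\ne 0$. Assume that all designs and all noise vectors are mutually independent, that $X^{(0)}$ and $X^{(q)}$ have i.i.d. standard Gaussian entries (so both covariances are $I_p$), and that each $\varepsilon^{(k)}$ has i.i.d. mean-zero entries with finite variance $\sigma_k^2>0$. Let $n_0\ge1$, $n_q\ge 1$ and $p>\max(n_0+1,\,n_q+1)$. Put $$\hat\beta_{\rm M}^{(k)}=\operatorname{argmin}\{\|\beta\|: X^{(k)}\beta=y^{(k)}\}\quad(k\in\{0,q\}),\qquad \hat\beta_{\rm TM}^{(q)}=\operatorname{argmin}\{\|\beta-\hat\beta_{\rm M}^{(q)}\|: X^{(0)}\beta=y^{(0)}\}$$ (minimum-norm interpolators, MNI, and the Transfer MNI, TM; they are almost surely uniquely defined). Let $x_0\in\mathbb R^p$ be a target instance,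 independent of all the data, with $\mathbb E\,x_0x_0^\top=I_p$. The excess risk of an estimate $\hat\beta$ is $\mathcal R(\hat\beta)=\mathbb E[(x_0^\top\hat\beta-x_0^\top\beta^{(0)})^2\mid X^{(0)},\dots,X^{(Q)}]$, and $\mathbb E\mathcal R_{\rm M}^{(0)}$, $\mathbb E\mathcal R_{\rm TM}^{(q)}$ denote the expectations over the designs of the excess risks of $\hat\beta_{\rm M}^{(0)}$ and $\hat\beta_{\rm TM}^{(q)}$. Let $$\mathrm{SSR}_q=\frac{\|\beta^{(q)}-\beta^{(0)}\|^2}{\|\beta^{(0)}\|^2},\qquad \mathrm{SNR}_q=\frac{\|\beta^{(0)}\|^2}{\sigma_q^2}.$$ (i) The squared losses are integrable, and $$\mathbb E\mathcal R_{\rm TM}^{(q)}<\mathbb E\mathcal R_{\rm M}^{(0)}\iff \mathrm{SSR}_q<1\ \text{ and }\ \mathrm{SNR}_q(1-\mathrm{SSR}_q)>\frac{p}{p-(n_q+1)}.$$ (ii) The improvement $\mathbb E\mathcal R_{\rm M}^{(0)}-\mathbb E\mathcal R_{\rm TM}^{(q)}$ equals $\Delta(n_q)$, where, all other quantities being fixed,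 for real $x\in[1,p-1)$, $$\Delta(x)=\frac{p-n_0}{p}\left(\frac{x}{p}\bigl(\|\beta^{(0)}\|^2-\|\beta^{(q)}-\beta^{(0)}\|^2\bigr)-\frac{\sigma_q^2\,x}{p-(x+1)}\right).$$ The function $\Delta$ is strictly concave on $[1,p-1)$. (iii) One has $\mathrm{SSR}_q<1$ and $\mathrm{SNR}_q(1-\mathrm{SSR}_q)\ge\frac{p(p-1)}{(p-2)^2}$ if and only if $\Delta$ has a maximizer over $[1,p-1)$ that equals $$n_q^*=p-1-\sqrt{\frac{p(p-1)}{\mathrm{SNR}_q(1-\mathrm{SSR}_q)}}\in[1,p-1);$$ equivalently, if and only if $\Delta$ has a maximizer over $[1,p-1)$ at which $\Delta'=0$. In this case $n_q^*$ is the unique maximizer of $\Delta$ over $[1,p-1)$, and the maximal improvement is $$\Delta(n_q^*)=\left(\frac{p-n_0}{p}\right)\left(\frac{(n_q^*)^2(1-\mathrm{SSR}_q)}{p(p-1)}\right)\|\beta^{(0)}\|^2>0 .$$ -/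

import Mathlib

open MeasureTheory ProbabilityTheory Set

/-- Matrices carry the product (Borel) measurable structure of their entries. -/
instance matrixMeasurableSpace {m p : ℕ} : MeasurableSpace (Matrix (Fin m) (Fin p) ℝ) :=
  inferInstanceAs (MeasurableSpace (Fin m → Fin p → ℝ))

/-- The set of coefficient vectors that interpolate the data `(X, y)`. -/
def interpolators {m p : ℕ} (X : Matrix (Fin m) (Fin p) ℝ) (y : Fin m → ℝ) :
    Set (EuclideanSpace ℝ (Fin p)) :=
  {b | X.mulVec b.ofLp = y}

/-- `argmin { ‖b - c‖ : X b = y }`. The minimizer is unique whenever the data can be interpolated;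
otherwise the value is arbitrary (a null event for a Gaussian design with `m ≤ p`). -/
noncomputable def nearestInterpolator {m p : ℕ} (X : Matrix (Fin m) (Fin p) ℝ) (y : Fin m → ℝ)
    (c : EuclideanSpace ℝ (Fin p)) : EuclideanSpace ℝ (Fin p) :=
  Classical.epsilon fun b =>
    b ∈ interpolators X y ∧ IsMinOn (fun b' => ‖b' - c‖) (interpolators X y) b

/-- The minimum-norm interpolator `argmin { ‖b‖ : X b = y }`. -/
noncomputable def minNormInterpolator {m p : ℕ} (X : Matrix (Fin m) (Fin p) ℝ) (y : Fin m → ℝ) :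
    EuclideanSpace ℝ (Fin p) :=
  nearestInterpolator X y 0

/-- Response vector of the linear model `y = X b + e`. -/
def response {m p : ℕ} (X : Matrix (Fin m) (Fin p) ℝ) (b : EuclideanSpace ℝ (Fin p))
    (e : Fin m → ℝ) : Fin m → ℝ :=
  X.mulVec b.ofLp + e

/-- The Transfer MNI: the interpolator of the target data `(X₀, y₀)` closest to the minimum-norm
interpolator of the source data `(X₁, y₁)`. -/
noncomputable def transferMNI {m₀ m₁ p : ℕ} (X₀ : Matrix (Fin m₀) (Fin p) ℝ) (y₀ : Fin m₀ → ℝ)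
    (X₁ : Matrix (Fin m₁) (Fin p) ℝ) (y₁ : Fin m₁ → ℝ) : EuclideanSpace ℝ (Fin p) :=
  nearestInterpolator X₀ y₀ (minNormInterpolator X₁ y₁)

/-- Target (index `0`) and `Q` source data sets with designs `X k`, noises `ε k`, noise levels
`σ k`, and an out-of-sample target instance `x₀`. The target and the `q`-th source designs have
i.i.d. standard Gaussian entries (identity covariance); nothing but measurability and independence
is required of the other designs. -/
structure IsIsotropicGaussianModel {Ω : Type*} [MeasurableSpace Ω] (μ : Measure Ω) {Q p : ℕ}
    (q : Fin (Q + 1)) (n : Fin (Q + 1) → ℕ) (σ : Fin (Q + 1) → ℝ)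
    (X : (k : Fin (Q + 1)) → Ω → Matrix (Fin (n k)) (Fin p) ℝ)
    (ε : (k : Fin (Q + 1)) → Ω → Fin (n k) → ℝ)
    (x₀ : Ω → Fin p → ℝ) : Prop where
  measurable_design : ∀ k, Measurable (X k)
  measurable_noise : ∀ k, Measurable (ε k)
  measurable_instance : Measurable x₀
  /-- All designs and all noise vectors are mutually independent. -/
  indep_design_noise : iIndep (Sum.elim
    (fun k : Fin (Q + 1) => MeasurableSpace.comap (X k) inferInstance)
    (fun k : Fin (Q + 1) => MeasurableSpace.comap (ε k) inferInstance)) μ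
  /-- The entries of the target and of the `q`-th design are i.i.d. standard Gaussian. -/
  indep_entries : ∀ k, k = 0 ∨ k = q →
    iIndepFun (fun (ij : Fin (n k) × Fin p) (ω : Ω) => X k ω ij.1 ij.2) μ
  gaussian_entries : ∀ k, k = 0 ∨ k = q → ∀ i j,
    μ.map (fun ω => X k ω i j) = gaussianReal 0 1
  /-- Each noise vector has i.i.d. centred components with variance `σ k ^ 2`. -/
  indep_noise : ∀ k, iIndepFun (fun (i : Fin (n k)) (ω : Ω) => ε k ω i) μ
  identDistrib_noise : ∀ k i j, IdentDistrib (fun ω => ε k ω i) (fun ω => ε k ω j) μ μ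
  memLp_noise : ∀ k i, MemLp (fun ω => ε k ω i) 2 μ
  mean_noise : ∀ k i, ∫ ω, ε k ω i ∂μ = 0
  variance_noise : ∀ k i, variance (fun ω => ε k ω i) μ = σ k ^ 2
  /-- The out-of-sample instance is independent of all the data and has second moment matrix
  equal to the identity. -/
  indep_instance : IndepFun x₀ (fun ω => ((fun k => X k ω), (fun k => ε k ω))) μ
  memLp_instance : ∀ j, MemLp (fun ω => x₀ ω j) 2 μ
  second_moment_instance : ∀ i j, ∫ ω, x₀ ω i * x₀ ω j ∂μ = if i = j then 1 else 0

/-- Squared prediction loss `(x₀ᵀ b̂ - x₀ᵀ b)²` of a random estimate `b̂`. -/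
noncomputable def excessLoss {Ω : Type*} {p : ℕ} (x₀ : Ω → Fin p → ℝ)
    (b : EuclideanSpace ℝ (Fin p)) (est : Ω → EuclideanSpace ℝ (Fin p)) (ω : Ω) : ℝ :=
  (x₀ ω ⬝ᵥ (est ω).ofLp - x₀ ω ⬝ᵥ b.ofLp) ^ 2

/-- Excess risk: the conditional expectation of the loss given all the designs. -/
noncomputable def excessRisk {Ω : Type*} [MeasurableSpace Ω] (μ : Measure Ω) {Q p : ℕ}
    {n : Fin (Q + 1) → ℕ} (X : (k : Fin (Q + 1)) → Ω → Matrix (Fin (n k)) (Fin p) ℝ)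
    (x₀ : Ω → Fin p → ℝ) (b : EuclideanSpace ℝ (Fin p))
    (est : Ω → EuclideanSpace ℝ (Fin p)) : Ω → ℝ :=
  condExp (⨆ k, MeasurableSpace.comap (X k) inferInstance) μ (excessLoss x₀ b est)

/-- Expected excess risk: the expectation of the excess risk over the designs. -/
noncomputable def expectedExcessRisk {Ω : Type*} [MeasurableSpace Ω] (μ : Measure Ω) {Q p : ℕ}
    {n : Fin (Q + 1) → ℕ} (X : (k : Fin (Q + 1)) → Ω → Matrix (Fin (n k)) (Fin p) ℝ)
    (x₀ : Ω → Fin p → ℝ) (b : EuclideanSpace ℝ (Fin p))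
    (est : Ω → EuclideanSpace ℝ (Fin p)) : ℝ :=
  ∫ ω, excessRisk μ X x₀ b est ω ∂μ

/-- The target-only MNI as a random vector. -/
noncomputable def targetEstimate {Ω : Type*} {Q p : ℕ} {n : Fin (Q + 1) → ℕ}
    (X : (k : Fin (Q + 1)) → Ω → Matrix (Fin (n k)) (Fin p) ℝ)
    (ε : (k : Fin (Q + 1)) → Ω → Fin (n k) → ℝ)
    (β : Fin (Q + 1) → EuclideanSpace ℝ (Fin p)) (ω : Ω) : EuclideanSpace ℝ (Fin p) :=
  minNormInterpolator (X 0 ω) (response (X 0 ω) (β 0) (ε 0 ω))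

/-- The Transfer MNI from the `q`-th source as a random vector. -/
noncomputable def transferEstimate {Ω : Type*} {Q p : ℕ} {n : Fin (Q + 1) → ℕ}
    (X : (k : Fin (Q + 1)) → Ω → Matrix (Fin (n k)) (Fin p) ℝ)
    (ε : (k : Fin (Q + 1)) → Ω → Fin (n k) → ℝ)
    (β : Fin (Q + 1) → EuclideanSpace ℝ (Fin p)) (q : Fin (Q + 1)) (ω : Ω) :
    EuclideanSpace ℝ (Fin p) :=
  transferMNI (X 0 ω) (response (X 0 ω) (β 0) (ε 0 ω)) (X q ω) (response (X q ω) (β q) (ε q ω))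

/-- Shift-to-signal ratio `‖β_q - β_0‖² / ‖β_0‖²`. -/
noncomputable def shiftToSignal {p : ℕ} (b₀ b₁ : EuclideanSpace ℝ (Fin p)) : ℝ :=
  ‖b₁ - b₀‖ ^ 2 / ‖b₀‖ ^ 2

/-- Signal-to-noise ratio `‖β_0‖² / σ_q²`. -/
noncomputable def signalToNoise {p : ℕ} (b₀ : EuclideanSpace ℝ (Fin p)) (s : ℝ) : ℝ :=
  ‖b₀‖ ^ 2 / s ^ 2

/-- The improvement in expected excess risk as a function of a real transfer size `x`: the
expression in `x` that equals the difference of the expected excess risks at every integer size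
(this equality is part of what the theorem claims). -/
noncomputable def improvement {p : ℕ} (n₀ : ℕ) (b₀ b₁ : EuclideanSpace ℝ (Fin p)) (s x : ℝ) : ℝ :=
  (p - n₀) / p * (x / p * (‖b₀‖ ^ 2 - ‖b₁ - b₀‖ ^ 2) - s ^ 2 * x / (p - (x + 1)))

/-- The optimal transfer size `p - 1 - √(p(p-1) / (SNR (1 - SSR)))`. -/
noncomputable def optimalSize {p : ℕ} (b₀ b₁ : EuclideanSpace ℝ (Fin p)) (s : ℝ) : ℝ :=
  p - 1 - √(p * (p - 1) / (signalToNoise b₀ s * (1 - shiftToSignal b₀ b₁)))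

/-!
Let `P` be the orthogonal projection onto the row space of a design `X` and `X⁺ = Xᵀ (X Xᵀ)⁻¹`. The
interpolator of `y = X b + e` closest to a centre `c` has error `(I - P) (c - b) + X⁺ e`
(`nearestInterpolator_response_sub`). The two summands are orthogonal, so the squared error is
`(c - b)ᵀ (I - P) (c - b) + eᵀ (X Xᵀ)⁻¹ e`, without a cross term. The target interpolator is the
case `c = 0`, and the transfer estimate the case where `c` is the source interpolator; their noise
terms cancel in the difference of the risks. What remains are two facts about a standard Gaussian
`n × p` matrix with `n + 1 < p`:

* `E P = (n / p) I` (`integral_rowProj_apply`), because the law is invariant under sign changes and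
  permutations of the columns, and `tr P = n`;
* `E (X Xᵀ)⁻¹ i i = 1 / (p - n - 1)` (`integrable_gram_inv_diag`), because this entry is the inverse
  of the squared distance of row `i` from the span of the other rows (`gram_cons`), a chi-square
  variable with `p - n + 1` degrees of freedom. The mean of an inverse chi-square variable comes
  from `1 / s = ∫ exp (-t s) dt` and the Laplace transform of a Gaussian quadratic form
  (`lintegral_inv_quadratic`). The finiteness of this mean also gives the almost sure full rank of
  `X`, by adding one row at a time (`ae_isUnit_gram`).

By independence the mean squared error of the source interpolator is
`(1 - n_q / p) ‖β₀‖² + (n_q / p) ‖β_q - β₀‖² + σ_q² n_q / (p - n_q - 1)`, to be compared with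
`‖β₀‖²` for the centre `0`; the target projection contributes the factor `1 - n₀ / p`.

For the optimization, write `N = p - 1` and `a = (‖β₀‖² - ‖β_q - β₀‖²) / p`. Up to a positive factor
and a constant, the improvement is `a x - σ² N / (N - x)`, which is strictly concave; its stationary
point solves `a (N - x)² = σ² N`, and with that equation the difference from the maximal value is a
nonnegative multiple of `(x - n*)²` (`isMaxOn_optimalSize`).
-/

/-! ### Pseudo-inverse, row projection and nearest interpolators -/

/-- The right pseudo-inverse `Xᵀ (X Xᵀ)⁻¹`. It is `0` when `X Xᵀ` is singular. -/
noncomputable def rightInv {n p : ℕ} (X : Matrix (Fin n) (Fin p) ℝ) : Matrix (Fin p) (Fin n) ℝ :=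
  X.transpose * (X * X.transpose)⁻¹

/-- The orthogonal projection `Xᵀ (X Xᵀ)⁻¹ X` onto the row space of `X`. It is `0` when `X Xᵀ` is
singular, and therefore always a symmetric idempotent. -/
noncomputable def rowProj {n p : ℕ} (X : Matrix (Fin n) (Fin p) ℝ) : Matrix (Fin p) (Fin p) ℝ :=
  rightInv X * X

section LinearAlgebra

variable {n p : ℕ} (X : Matrix (Fin n) (Fin p) ℝ)

lemma gram_inv_mul_gram_mul_inv :
    (X * X.transpose)⁻¹ * (X * X.transpose) * (X * X.transpose)⁻¹ = (X * X.transpose)⁻¹ := by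
  by_cases h : IsUnit (X * X.transpose).det
  · rw [Matrix.nonsing_inv_mul _ h, one_mul]
  · simp [Matrix.nonsing_inv_apply_not_isUnit _ h]

lemma gram_inv_transpose : ((X * X.transpose)⁻¹).transpose = (X * X.transpose)⁻¹ := by
  rw [Matrix.transpose_nonsing_inv, Matrix.transpose_mul, Matrix.transpose_transpose]

lemma rightInv_transpose : (rightInv X).transpose = (X * X.transpose)⁻¹ * X := by
  rw [rightInv, Matrix.transpose_mul, gram_inv_transpose, Matrix.transpose_transpose]

lemma rightInv_transpose_mul_rightInv :
    (rightInv X).transpose * rightInv X = (X * X.transpose)⁻¹ := by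
  rw [rightInv_transpose, rightInv]
  conv_rhs => rw [← gram_inv_mul_gram_mul_inv]
  simp only [Matrix.mul_assoc]

lemma rowProj_transpose : (rowProj X).transpose = rowProj X := by
  rw [rowProj, Matrix.transpose_mul, rightInv_transpose, rightInv, Matrix.mul_assoc]

lemma rowProj_mul_rightInv : rowProj X * rightInv X = rightInv X := by
  rw [rowProj, rightInv]
  conv_rhs => rw [← gram_inv_mul_gram_mul_inv]
  simp only [Matrix.mul_assoc]

lemma rowProj_mul_self : rowProj X * rowProj X = rowProj X := by
  conv_lhs => rw [rowProj.eq_def X, ← Matrix.mul_assoc, ← rowProj.eq_def X, rowProj_mul_rightInv]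
  rfl

lemma mul_rightInv (h : IsUnit (X * X.transpose).det) : X * rightInv X = 1 := by
  rw [rightInv, ← Matrix.mul_assoc, Matrix.mul_nonsing_inv _ h]

lemma mul_rowProj (h : IsUnit (X * X.transpose).det) : X * rowProj X = X := by
  rw [rowProj, ← Matrix.mul_assoc, mul_rightInv X h, Matrix.one_mul]

lemma trace_rowProj (h : IsUnit (X * X.transpose).det) : (rowProj X).trace = n := by
  rw [rowProj, Matrix.trace_mul_comm, mul_rightInv X h]
  simp

lemma one_sub_rowProj_transpose : (1 - rowProj X).transpose = 1 - rowProj X := by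
  rw [Matrix.transpose_sub, rowProj_transpose, Matrix.transpose_one]

lemma one_sub_rowProj_mul_self : (1 - rowProj X) * (1 - rowProj X) = 1 - rowProj X := by
  rw [mul_sub, sub_mul, sub_mul, rowProj_mul_self]; simp

lemma one_sub_rowProj_mul_rightInv : (1 - rowProj X) * rightInv X = 0 := by
  rw [Matrix.sub_mul, rowProj_mul_rightInv]; simp

lemma mul_one_sub_rowProj (h : IsUnit (X * X.transpose).det) : X * (1 - rowProj X) = 0 := by
  rw [Matrix.mul_sub, mul_rowProj X h]; simp

/-- Off-diagonal entries of a matrix of the form `Aᵀ A` are controlled by the diagonal ones. -/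
lemma abs_transpose_mul_apply_le {k m : ℕ} (A : Matrix (Fin k) (Fin m) ℝ) (i j : Fin m) :
    |(A.transpose * A) i j| ≤ (A.transpose * A) i i + (A.transpose * A) j j := by
  simp only [Matrix.mul_apply, Matrix.transpose_apply]
  rw [← Finset.sum_add_distrib]
  refine (Finset.abs_sum_le_sum_abs _ _).trans (Finset.sum_le_sum fun l _ => ?_)
  rw [abs_le]
  constructor <;> nlinarith [sq_nonneg (A l i - A l j), sq_nonneg (A l i + A l j),
    sq_nonneg (A l i), sq_nonneg (A l j)]

lemma sq_le_transpose_mul_apply {k m : ℕ} (A : Matrix (Fin k) (Fin m) ℝ) (l : Fin k) (i : Fin m) :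
    A l i ^ 2 ≤ (A.transpose * A) i i := by
  simp only [Matrix.mul_apply, Matrix.transpose_apply]
  rw [sq]
  exact Finset.single_le_sum (f := fun l => A l i * A l i) (fun l _ => mul_self_nonneg _)
    (Finset.mem_univ l)

lemma abs_rowProj_apply_le (i j : Fin p) : |rowProj X i j| ≤ 2 := by
  have h : (rowProj X).transpose * rowProj X = rowProj X := by
    rw [rowProj_transpose, rowProj_mul_self]
  have hd : ∀ i, rowProj X i i ≤ 1 := fun i => by
    have := sq_le_transpose_mul_apply (rowProj X) i i
    rw [h] at this
    nlinarith
  have := abs_transpose_mul_apply_le (rowProj X) i j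
  rw [h] at this
  linarith [hd i, hd j]

lemma dotProduct_mulVec_self_eq {m k : ℕ} (A : Matrix (Fin m) (Fin k) ℝ) (v : Fin k → ℝ) :
    A.mulVec v ⬝ᵥ A.mulVec v = v ⬝ᵥ (A.transpose * A).mulVec v := by
  rw [← Matrix.mulVec_mulVec, Matrix.dotProduct_mulVec v, Matrix.vecMul_transpose]

/-- The squared length of `(I - P) u + X⁺ e` has no cross term, whatever `u` and `e` are. -/
lemma dotProduct_self_proj_add (u : Fin p → ℝ) (e : Fin n → ℝ) :
    ((1 - rowProj X).mulVec u + (rightInv X).mulVec e) ⬝ᵥ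
        ((1 - rowProj X).mulVec u + (rightInv X).mulVec e)
      = u ⬝ᵥ (1 - rowProj X).mulVec u + e ⬝ᵥ ((X * X.transpose)⁻¹).mulVec e := by
  have h : (1 - rowProj X).mulVec u ⬝ᵥ (rightInv X).mulVec e = 0 := by
    rw [← Matrix.vecMul_transpose, one_sub_rowProj_transpose, ← Matrix.dotProduct_mulVec,
      Matrix.mulVec_mulVec, one_sub_rowProj_mul_rightInv]
    simp
  rw [add_dotProduct, dotProduct_add, dotProduct_add, h,
    dotProduct_comm ((rightInv X).mulVec e), h, dotProduct_mulVec_self_eq,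
    dotProduct_mulVec_self_eq, one_sub_rowProj_transpose, one_sub_rowProj_mul_self,
    rightInv_transpose_mul_rightInv]
  ring

/-- Adding a row `x` to `A`: with `s` the squared distance of `x` from the row space of `A`, the
Gram matrix of the enlarged matrix is invertible when `s ≠ 0`, and the corner entry of its inverse
is `1 / s`. The column of the inverse is `s⁻¹ (1, -(A Aᵀ)⁻¹ A x)`. -/
lemma gram_cons (A : Matrix (Fin n) (Fin p) ℝ) (x : Fin p → ℝ)
    (hA : IsUnit (A * A.transpose).det) (hs : x ⬝ᵥ (1 - rowProj A).mulVec x ≠ 0)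
    (Y : Matrix (Fin (n + 1)) (Fin p) ℝ) (hY0 : Y 0 = x) (hYs : ∀ i : Fin n, Y i.succ = A i) :
    IsUnit (Y * Y.transpose).det ∧
      (Y * Y.transpose)⁻¹ 0 0 = (x ⬝ᵥ (1 - rowProj A).mulVec x)⁻¹ := by
  have hYv : ∀ v, Y.mulVec v = Fin.cons (x ⬝ᵥ v) (A.mulVec v) := by
    intro v; funext i
    refine Fin.cases ?_ (fun i => ?_) i
    · rw [Fin.cons_zero, ← hY0]; rfl
    · simp only [Fin.cons_succ, Matrix.mulVec, hYs]
  have hYt : ∀ w : Fin (n + 1) → ℝ,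
      Y.transpose.mulVec w = w 0 • x + A.transpose.mulVec (fun i => w i.succ) := by
    intro w; funext j
    simp only [Matrix.mulVec, dotProduct, Fin.sum_univ_succ, Matrix.transpose_apply, hY0, hYs,
      Pi.add_apply, Pi.smul_apply, smul_eq_mul]
    ring
  set s := x ⬝ᵥ (1 - rowProj A).mulVec x with hsdef
  have hinj : Function.Injective (Y * Y.transpose).mulVec := by
    rw [← Matrix.coe_mulVecLin, ← LinearMap.ker_eq_bot, LinearMap.ker_eq_bot']
    intro v hv
    rw [Matrix.mulVecLin_apply, ← Matrix.mulVec_mulVec] at hv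
    have h0 : Y.transpose.mulVec v = 0 := by
      have : Y.transpose.mulVec v ⬝ᵥ Y.transpose.mulVec v = 0 := by
        rw [dotProduct_mulVec_self_eq, Matrix.transpose_transpose, ← Matrix.mulVec_mulVec, hv]
        simp
      simpa using this
    rw [hYt] at h0
    have hv0 : v 0 = 0 := by
      have h1 : x ⬝ᵥ (1 - rowProj A).mulVec
          (v 0 • x + A.transpose.mulVec fun i : Fin n => v i.succ) = 0 := by
        rw [h0]; simp
      have h2 : (1 - rowProj A) * A.transpose = 0 := by
        have := congrArg Matrix.transpose (mul_one_sub_rowProj A hA)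
        rwa [Matrix.transpose_mul, one_sub_rowProj_transpose, Matrix.transpose_zero] at this
      rw [Matrix.mulVec_add, Matrix.mulVec_mulVec, h2, Matrix.mulVec_smul, Matrix.zero_mulVec,
        add_zero, dotProduct_smul, smul_eq_mul, ← hsdef] at h1
      exact (mul_eq_zero.1 h1).resolve_right hs
    rw [hv0, zero_smul, zero_add] at h0
    have h3 : (A * A.transpose).mulVec (fun i : Fin n => v i.succ) = 0 := by
      rw [← Matrix.mulVec_mulVec, h0, Matrix.mulVec_zero]
    have h4 : (fun i : Fin n => v i.succ) = 0 := by
      have := congrArg ((A * A.transpose)⁻¹).mulVec h3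
      rwa [Matrix.mulVec_mulVec, Matrix.nonsing_inv_mul _ hA, Matrix.one_mulVec,
        Matrix.mulVec_zero] at this
    funext i
    refine Fin.cases hv0 (fun i => congrFun h4 i) i
  have hu : IsUnit (Y * Y.transpose).det :=
    (Matrix.isUnit_iff_isUnit_det _).1 (Matrix.mulVec_injective_iff_isUnit.1 hinj)
  refine ⟨hu, ?_⟩
  let w : Fin (n + 1) → ℝ := Fin.cons 1 (-((A * A.transpose)⁻¹ * A).mulVec x)
  have hw : (Y * Y.transpose).mulVec w = Pi.single 0 s := by
    have h1 : Y.transpose.mulVec w = (1 - rowProj A).mulVec x := by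
      rw [hYt]
      simp only [w, Fin.cons_zero, Fin.cons_succ, one_smul]
      change x + A.transpose.mulVec (-((A * A.transpose)⁻¹ * A).mulVec x) = _
      rw [Matrix.mulVec_neg, Matrix.mulVec_mulVec, ← Matrix.mul_assoc, Matrix.sub_mulVec,
        Matrix.one_mulVec, ← sub_eq_add_neg]
      rfl
    rw [← Matrix.mulVec_mulVec, h1, hYv, Matrix.mulVec_mulVec, mul_one_sub_rowProj A hA,
      Matrix.zero_mulVec]
    funext i
    refine Fin.cases ?_ (fun i => ?_) i <;> simp [hsdef]
  have h5 := congrArg (fun v => ((Y * Y.transpose)⁻¹).mulVec v 0) hw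
  simp only [Matrix.mulVec_mulVec, Matrix.nonsing_inv_mul _ hu, Matrix.one_mulVec,
    Matrix.mulVec_single, w, Fin.cons_zero] at h5
  simp at h5
  exact eq_inv_of_mul_eq_one_left h5.symm

lemma EuclideanSpace.ofLp_dotProduct_self {p : ℕ} (b : EuclideanSpace ℝ (Fin p)) :
    b.ofLp ⬝ᵥ b.ofLp = ‖b‖ ^ 2 := by
  rw [EuclideanSpace.norm_sq_eq]
  simp [dotProduct, sq]

/-- When the data can be interpolated, the interpolator closest to `c` is unique and equals
`c + X⁺ (y - X c)`. -/
lemma nearestInterpolator_eq (h : IsUnit (X * X.transpose).det) (y : Fin n → ℝ)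
    (c : EuclideanSpace ℝ (Fin p)) :
    (nearestInterpolator X y c).ofLp
      = c.ofLp + (rightInv X).mulVec (y - X.mulVec c.ofLp) := by
  set b : EuclideanSpace ℝ (Fin p) :=
    WithLp.toLp 2 (c.ofLp + (rightInv X).mulVec (y - X.mulVec c.ofLp)) with hb
  have hmem : b ∈ interpolators X y := by
    change X.mulVec (c.ofLp + (rightInv X).mulVec (y - X.mulVec c.ofLp)) = y
    rw [Matrix.mulVec_add, Matrix.mulVec_mulVec, mul_rightInv X h, Matrix.one_mulVec]
    abel
  -- Pythagoras: a difference of interpolators is orthogonal to the row space.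
  have hpyth : ∀ b' ∈ interpolators X y, ‖b' - c‖ ^ 2 = ‖b' - b‖ ^ 2 + ‖b - c‖ ^ 2 := by
    intro b' hb'
    have h1 : X.mulVec (b' - b).ofLp = 0 := by
      have h2 : X.mulVec b'.ofLp = y := hb'
      have h3 : X.mulVec b.ofLp = y := hmem
      rw [WithLp.ofLp_sub, Matrix.mulVec_sub, h2, h3, sub_self]
    have h2 : (b - c).ofLp
        = X.transpose.mulVec (((X * X.transpose)⁻¹).mulVec (y - X.mulVec c.ofLp)) := by
      rw [Matrix.mulVec_mulVec]
      simp [hb, rightInv]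
    have h3 : (b' - b).ofLp ⬝ᵥ (b - c).ofLp = 0 := by
      rw [h2, Matrix.dotProduct_mulVec, Matrix.vecMul_transpose, h1, zero_dotProduct]
    have h4 : b' - c = (b' - b) + (b - c) := by abel
    simp only [h4, ← EuclideanSpace.ofLp_dotProduct_self]
    rw [WithLp.ofLp_add, add_dotProduct, dotProduct_add, dotProduct_add, h3,
      dotProduct_comm (b - c).ofLp, h3]
    ring
  have hex : ∃ b', b' ∈ interpolators X y ∧
      IsMinOn (fun b' => ‖b' - c‖) (interpolators X y) b' := by
    refine ⟨b, hmem, fun b' hb' => ?_⟩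
    have := hpyth b' hb'
    exact abs_le_of_sq_le_sq' (by nlinarith [sq_nonneg ‖b' - b‖]) (norm_nonneg _) |>.2
  obtain ⟨h1, h2⟩ := Classical.epsilon_spec hex
  have h3 : ‖nearestInterpolator X y c - c‖ ≤ ‖b - c‖ := h2 hmem
  have h4 := hpyth _ h1
  change ‖nearestInterpolator X y c - c‖ ^ 2 = ‖nearestInterpolator X y c - b‖ ^ 2 + _ at h4
  have h5 : ‖nearestInterpolator X y c - b‖ = 0 := by
    nlinarith [norm_nonneg (nearestInterpolator X y c - c), norm_nonneg (b - c),
      norm_nonneg (nearestInterpolator X y c - b)]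
  rw [norm_eq_zero, sub_eq_zero] at h5
  rw [h5]

/-- Estimation error of the interpolator closest to `c` in the model `y = X b + e`. -/
lemma nearestInterpolator_response_sub (h : IsUnit (X * X.transpose).det)
    (b c : EuclideanSpace ℝ (Fin p)) (e : Fin n → ℝ) :
    (nearestInterpolator X (response X b e) c).ofLp - b.ofLp
      = (1 - rowProj X).mulVec (c.ofLp - b.ofLp) + (rightInv X).mulVec e := by
  rw [nearestInterpolator_eq X h, response, Matrix.sub_mulVec, Matrix.one_mulVec, rowProj,
    ← Matrix.mulVec_mulVec, Matrix.mulVec_sub X, add_sub_assoc, add_comm _ e,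
    ← sub_sub_eq_add_sub, sub_sub_eq_add_sub]
  simp only [Matrix.mulVec_sub, Matrix.mulVec_add]
  abel

end LinearAlgebra

/-! ### Inverse moments of Gaussian quadratic forms -/

lemma integral_exp_neg_mul_sq_gaussianReal {c : ℝ} (hc : 0 ≤ c) :
    ∫ x, Real.exp (-(c * x ^ 2)) ∂(gaussianReal 0 1) = (√(1 + 2 * c))⁻¹ := by
  rw [integral_gaussianReal_eq_integral_smul one_ne_zero]
  have h1 : ∀ x : ℝ, gaussianPDFReal 0 1 x • Real.exp (-(c * x ^ 2))
      = (√(2 * Real.pi))⁻¹ * Real.exp (-(1 / 2 + c) * x ^ 2) := fun x => by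
    rw [gaussianPDFReal, smul_eq_mul, mul_assoc, ← Real.exp_add, NNReal.coe_one, mul_one, mul_one]
    congr 2
    ring
  simp_rw [h1]
  rw [integral_const_mul, integral_gaussian, ← Real.sqrt_inv, ← Real.sqrt_inv,
    ← Real.sqrt_mul (by positivity)]
  congr 1
  field_simp

/-- Laplace transform of a Gaussian quadratic form given by an orthogonal projection of rank `k`:
in an orthonormal eigenbasis the form is a sum of `k` squared coordinates, and the standard
Gaussian law is the same in every orthonormal basis. -/
lemma integral_exp_neg_quadratic {p k : ℕ} (R : Matrix (Fin p) (Fin p) ℝ)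
    (hsym : R.transpose = R) (hidem : R * R = R) (htr : R.trace = k) {t : ℝ} (ht : 0 ≤ t) :
    ∫ x, Real.exp (-(t * (x ⬝ᵥ R.mulVec x))) ∂(Measure.pi fun _ : Fin p => gaussianReal 0 1)
      = (√(1 + 2 * t))⁻¹ ^ k := by
  have hH : R.IsHermitian := by
    rw [Matrix.IsHermitian, Matrix.conjTranspose_eq_transpose_of_trivial, hsym]
  set v := hH.eigenvectorBasis
  set ev := hH.eigenvalues
  have hRv : ∀ i, R.mulVec (v i).ofLp = ev i • (v i).ofLp := hH.mulVec_eigenvectorBasis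
  have h01 : ∀ i, ev i = 0 ∨ ev i = 1 := by
    intro i
    have h1 := congrArg R.mulVec (hRv i)
    rw [Matrix.mulVec_mulVec, hidem, Matrix.mulVec_smul, hRv, smul_smul] at h1
    have h2 : (ev i - ev i * ev i) • v i = 0 := by
      ext j
      have := congrFun h1 j
      simp only [Pi.smul_apply, smul_eq_mul] at this
      simp only [PiLp.smul_apply, smul_eq_mul, PiLp.zero_apply]
      linarith
    have h3 := (smul_eq_zero.1 h2).resolve_right (v.orthonormal.ne_zero i)
    have h4 : ev i * (1 - ev i) = 0 := by linarith
    rcases mul_eq_zero.1 h4 with h | h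
    · exact Or.inl h
    · exact Or.inr (by linarith)
  have hquad : ∀ z : Fin p → ℝ,
      (∑ i, z i • v i).ofLp ⬝ᵥ R.mulVec (∑ i, z i • v i).ofLp = ∑ i, ev i * z i ^ 2 := by
    intro z
    have h1 : R.mulVec (∑ i, z i • v i).ofLp = (∑ i, (ev i * z i) • v i).ofLp := by
      simp only [WithLp.ofLp_sum, WithLp.ofLp_smul]
      rw [← Matrix.mulVecLin_apply, map_sum]
      refine Finset.sum_congr rfl fun i _ => ?_
      rw [map_smul, Matrix.mulVecLin_apply, hRv, smul_smul, mul_comm]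
    have h2 := v.orthonormal.inner_sum (fun i => ev i * z i) z Finset.univ
    rw [EuclideanSpace.inner_eq_star_dotProduct] at h2
    rw [h1]
    simp only [star_trivial, conj_trivial] at h2
    rw [h2]
    exact Finset.sum_congr rfl fun i _ => by ring
  have hmap : ∫ x, Real.exp (-(t * (x ⬝ᵥ R.mulVec x)))
        ∂(Measure.pi fun _ : Fin p => gaussianReal 0 1)
      = ∫ z : Fin p → ℝ, Real.exp (-(t * ((∑ i, z i • v i).ofLp ⬝ᵥ
          R.mulVec (∑ i, z i • v i).ofLp))) ∂(Measure.pi fun _ : Fin p => gaussianReal 0 1) := by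
    have h1 := map_pi_eq_stdGaussian (ι := Fin p)
    rw [stdGaussian_eq_map_pi_orthonormalBasis v] at h1
    have hc : Continuous fun x : EuclideanSpace ℝ (Fin p) =>
        Real.exp (-(t * (x.ofLp ⬝ᵥ R.mulVec x.ofLp))) := by fun_prop
    have h2 := congrArg (fun ν => ∫ x : EuclideanSpace ℝ (Fin p),
      Real.exp (-(t * (x.ofLp ⬝ᵥ R.mulVec x.ofLp))) ∂ν) h1
    simp only at h2
    have hm : Measurable fun x : Fin p → ℝ => ∑ i, x i • v i := by fun_prop
    rw [integral_map hm.aemeasurable hc.aestronglyMeasurable,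
      integral_map (by fun_prop) hc.aestronglyMeasurable] at h2
    exact h2
  rw [hmap]
  have hprod : ∀ z : Fin p → ℝ, Real.exp (-(t * ((∑ i, z i • v i).ofLp ⬝ᵥ
      R.mulVec (∑ i, z i • v i).ofLp))) = ∏ i, Real.exp (-((t * ev i) * z i ^ 2)) := by
    intro z
    rw [hquad, ← Real.exp_sum, Finset.mul_sum, ← Finset.sum_neg_distrib]
    simp only [mul_assoc]
  simp_rw [hprod]
  rw [integral_fintype_prod_eq_prod (fun i x => Real.exp (-((t * ev i) * x ^ 2)))]
  have hfac : ∀ i, ∫ x, Real.exp (-((t * ev i) * x ^ 2)) ∂(gaussianReal 0 1)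
      = if ev i = 1 then (√(1 + 2 * t))⁻¹ else 1 := by
    intro i
    rcases h01 i with h | h
    · simp [h]
    · simp [h, integral_exp_neg_mul_sq_gaussianReal ht]
  have hcard : ((Finset.univ.filter fun i => ev i = 1).card : ℝ) = k := by
    rw [← htr, hH.trace_eq_sum_eigenvalues, Finset.card_filter, Nat.cast_sum]
    refine Finset.sum_congr rfl fun i _ => ?_
    change _ = ev i
    rcases h01 i with h | h <;> simp [h]
  simp_rw [hfac]
  rw [Finset.prod_ite, Finset.prod_const, Finset.prod_const_one, mul_one]
  congr 1
  exact_mod_cast hcard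

lemma lintegral_Ioi_inv_sqrt_pow {m : ℕ} (hm : 1 ≤ m) :
    ∫⁻ t in Ioi (0 : ℝ), ENNReal.ofReal ((√(1 + 2 * t))⁻¹ ^ (m + 2))
      = ENNReal.ofReal (1 / m) := by
  have hm' : (m : ℝ) ≠ 0 := by positivity
  have hd : ∀ t ∈ Ici (0 : ℝ), HasDerivAt (fun t : ℝ => -(1 / m) * (√(1 + 2 * t))⁻¹ ^ m)
      ((√(1 + 2 * t))⁻¹ ^ (m + 2)) t := by
    intro t ht
    have ht' : (0 : ℝ) ≤ t := ht
    have h0 : 1 + 2 * t ≠ 0 := by positivity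
    have h1 : HasDerivAt (fun t : ℝ => 1 + 2 * t) 2 t := by
      simpa using ((hasDerivAt_id t).const_mul 2).const_add 1
    have h2 : √(1 + 2 * t) ≠ 0 := by positivity
    refine ((((h1.sqrt h0).fun_inv h2).fun_pow m).const_mul (-(1 / (m : ℝ)))).congr_deriv ?_
    obtain ⟨k, rfl⟩ : ∃ k, m = k + 1 := ⟨m - 1, by omega⟩
    simp only [Nat.add_sub_cancel]
    rw [show k + 1 + 2 = k + 3 from rfl, pow_add]
    field_simp
  have hnn : ∀ t ∈ Ioi (0 : ℝ), 0 ≤ (√(1 + 2 * t))⁻¹ ^ (m + 2) := fun t _ => by positivity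
  have hlim : Filter.Tendsto (fun t : ℝ => -(1 / (m : ℝ)) * (√(1 + 2 * t))⁻¹ ^ m) Filter.atTop
      (nhds 0) := by
    have h1 : Filter.Tendsto (fun t : ℝ => 1 + 2 * t) Filter.atTop Filter.atTop :=
      Filter.tendsto_atTop_add_const_left _ _ (Filter.tendsto_id.const_mul_atTop two_pos)
    have h2 := (((Real.tendsto_sqrt_atTop.comp h1).inv_tendsto_atTop).pow m).const_mul
      (-(1 / (m : ℝ)))
    rw [zero_pow (by omega), mul_zero] at h2
    exact h2
  have hint := integral_Ioi_of_hasDerivAt_of_nonneg' hd hnn hlim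
  rw [← ofReal_integral_eq_lintegral_ofReal (integrableOn_Ioi_deriv_of_nonneg' hd hnn hlim)
    ((ae_restrict_iff' measurableSet_Ioi).2 (ae_of_all _ hnn)), hint]
  simp

lemma inv_ofReal_eq_lintegral {s : ℝ} (hs : 0 ≤ s) :
    (ENNReal.ofReal s)⁻¹ = ∫⁻ t in Ioi (0 : ℝ), ENNReal.ofReal (Real.exp (-(t * s))) := by
  rcases hs.eq_or_lt with rfl | hs
  · simp
  · have h1 : ∀ t : ℝ, -(t * s) = -s * t := fun t => by ring
    simp_rw [h1]
    rw [← ofReal_integral_eq_lintegral_ofReal (integrableOn_exp_mul_Ioi (by linarith) 0)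
      (ae_of_all _ fun t => (Real.exp_pos _).le), integral_exp_mul_Ioi (by linarith),
      ← ENNReal.ofReal_inv_of_pos hs]
    simp

lemma quadratic_nonneg {p : ℕ} (R : Matrix (Fin p) (Fin p) ℝ)
    (hsym : R.transpose = R) (hidem : R * R = R) (x : Fin p → ℝ) : 0 ≤ x ⬝ᵥ R.mulVec x := by
  have h : x ⬝ᵥ R.mulVec x = R.mulVec x ⬝ᵥ R.mulVec x := by
    rw [dotProduct_mulVec_self_eq, hsym, hidem]
  rw [h]
  exact Finset.sum_nonneg fun i _ => mul_self_nonneg _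

/-- The mean of an inverse chi-square variable with `m + 2` degrees of freedom is `1 / m`. It is
obtained from `1 / s = ∫ exp (-t s) dt` and the Laplace transform. In `ℝ≥0∞` the inverse of `0` is
`⊤`, so the formula also shows that the quadratic form is almost surely nonzero. -/
lemma lintegral_inv_quadratic {p m : ℕ} (hm : 1 ≤ m) (R : Matrix (Fin p) (Fin p) ℝ)
    (hsym : R.transpose = R) (hidem : R * R = R) (htr : R.trace = (m + 2 : ℕ)) :
    ∫⁻ x, (ENNReal.ofReal (x ⬝ᵥ R.mulVec x))⁻¹ ∂(Measure.pi fun _ : Fin p => gaussianReal 0 1)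
      = ENNReal.ofReal (1 / m) := by
  simp_rw [fun x => inv_ofReal_eq_lintegral (quadratic_nonneg R hsym hidem x)]
  rw [lintegral_lintegral_swap (by
    refine Measurable.aemeasurable ?_
    have : Continuous fun z : (Fin p → ℝ) × ℝ => Real.exp (-(z.2 * (z.1 ⬝ᵥ R.mulVec z.1))) := by
      fun_prop
    exact ENNReal.measurable_ofReal.comp this.measurable), ← lintegral_Ioi_inv_sqrt_pow hm]
  refine setLIntegral_congr_fun measurableSet_Ioi fun t ht => ?_
  have ht' : (0 : ℝ) ≤ t := le_of_lt ht
  have hc : Continuous fun x : Fin p → ℝ => Real.exp (-(t * (x ⬝ᵥ R.mulVec x))) := by fun_prop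
  rw [← integral_exp_neg_quadratic R hsym hidem htr ht', ofReal_integral_eq_lintegral_ofReal ?_
    (ae_of_all _ fun x => (Real.exp_pos _).le)]
  refine Integrable.of_bound hc.aestronglyMeasurable 1 (ae_of_all _ fun x => ?_)
  rw [Real.norm_of_nonneg (Real.exp_pos _).le, Real.exp_le_one_iff]
  have := mul_nonneg ht' (quadratic_nonneg R hsym hidem x)
  linarith

lemma ae_quadratic_ne_zero {p m : ℕ} (hm : 1 ≤ m) (R : Matrix (Fin p) (Fin p) ℝ)
    (hsym : R.transpose = R) (hidem : R * R = R) (htr : R.trace = (m + 2 : ℕ)) :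
    ∀ᵐ x ∂(Measure.pi fun _ : Fin p => gaussianReal 0 1), x ⬝ᵥ R.mulVec x ≠ 0 := by
  have hc : Continuous fun x : Fin p → ℝ => x ⬝ᵥ R.mulVec x := by fun_prop
  have h := ae_lt_top (f := fun x => (ENNReal.ofReal (x ⬝ᵥ R.mulVec x))⁻¹)
    (μ := Measure.pi fun _ : Fin p => gaussianReal 0 1) hc.measurable.ennreal_ofReal.inv
    (by rw [lintegral_inv_quadratic hm R hsym hidem htr]; exact ENNReal.ofReal_ne_top)
  filter_upwards [h] with x hx h0
  simp [h0] at hx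

/-- The law of an `n × p` matrix with independent standard Gaussian entries, on the underlying
function space. -/
noncomputable def gaussianMatrix (n p : ℕ) : Measure (Fin n → Fin p → ℝ) :=
  Measure.pi fun _ => Measure.pi fun _ => gaussianReal 0 1

instance gaussianMatrix_isProbabilityMeasure (n p : ℕ) :
    IsProbabilityMeasure (gaussianMatrix n p) := by
  rw [gaussianMatrix]; infer_instance

/-! ### Measurability of pseudo-inverse and projection -/

section Measurability

variable {n p : ℕ}

lemma measurable_gram_inv_apply (i j : Fin n) :
    Measurable fun X : Matrix (Fin n) (Fin p) ℝ => (X * X.transpose)⁻¹ i j := by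
  change Measurable fun X : Fin n → Fin p → ℝ =>
    ((Matrix.of X) * (Matrix.of X).transpose)⁻¹ i j
  have hc : Continuous fun X : Fin n → Fin p → ℝ => (Matrix.of X) * (Matrix.of X).transpose :=
    Continuous.matrix_mul continuous_id (Continuous.matrix_transpose continuous_id)
  simp only [Matrix.inv_def, Ring.inverse_eq_inv', Matrix.smul_apply, smul_eq_mul]
  exact (hc.matrix_det.measurable.inv).mul (hc.matrix_adjugate.matrix_elem i j).measurable

lemma measurable_matrix_apply (i : Fin n) (j : Fin p) :
    Measurable fun X : Matrix (Fin n) (Fin p) ℝ => X i j :=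
  (measurable_pi_apply j).comp (measurable_pi_apply i)

lemma measurable_matrix_iff {Ω : Type*} [MeasurableSpace Ω] {f : Ω → Matrix (Fin n) (Fin p) ℝ} :
    Measurable f ↔ ∀ i j, Measurable fun ω => f ω i j :=
  measurable_pi_iff.trans (forall_congr' fun _ => measurable_pi_iff)

lemma measurable_gram_inv :
    Measurable fun X : Matrix (Fin n) (Fin p) ℝ => (X * X.transpose)⁻¹ :=
  measurable_matrix_iff.2 measurable_gram_inv_apply

lemma measurable_rightInv : Measurable (rightInv : Matrix (Fin n) (Fin p) ℝ → _) := by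
  refine measurable_matrix_iff.2 fun i j => ?_
  simp only [rightInv, Matrix.mul_apply, Matrix.transpose_apply]
  exact Finset.measurable_sum _ fun k _ =>
    (measurable_matrix_apply k i).mul (measurable_gram_inv_apply k j)

lemma measurable_rowProj : Measurable (rowProj : Matrix (Fin n) (Fin p) ℝ → _) := by
  refine measurable_matrix_iff.2 fun i j => ?_
  simp only [rowProj, Matrix.mul_apply (M := rightInv _)]
  exact Finset.measurable_sum _ fun k _ =>
    ((measurable_matrix_iff.1 measurable_rightInv i k)).mul (measurable_matrix_apply k j)

lemma measurable_mulVec {Ω : Type*} [MeasurableSpace Ω] {A : Ω → Matrix (Fin n) (Fin p) ℝ}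
    {v : Ω → Fin p → ℝ} (hA : Measurable A) (hv : Measurable v) :
    Measurable fun ω => (A ω).mulVec (v ω) := by
  refine measurable_pi_iff.2 fun i => ?_
  simp only [Matrix.mulVec, dotProduct]
  exact Finset.measurable_sum _ fun k _ =>
    (measurable_matrix_iff.1 hA i k).mul (measurable_pi_iff.1 hv k)

lemma measurableSet_isUnit_gram :
    MeasurableSet {X : Fin n → Fin p → ℝ |
      IsUnit ((Matrix.of X) * (Matrix.of X).transpose).det} := by
  have hc : Continuous fun X : Fin n → Fin p → ℝ => (Matrix.of X) * (Matrix.of X).transpose :=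
    Continuous.matrix_mul continuous_id (Continuous.matrix_transpose continuous_id)
  simp only [isUnit_iff_ne_zero]
  exact hc.matrix_det.measurable (measurableSet_singleton 0).compl

lemma measurable_cons :
    Measurable fun z : (Fin p → ℝ) × (Fin n → Fin p → ℝ) =>
      (Fin.cons z.1 z.2 : Fin (n + 1) → Fin p → ℝ) := by
  refine measurable_pi_iff.2 fun i => ?_
  refine Fin.cases ?_ (fun i => ?_) i
  · exact measurable_fst
  · exact (measurable_pi_apply i).comp measurable_snd

end Measurability

/-! ### Full rank and the mean of the inverse Wishart matrix -/

section FullRank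

variable {n p : ℕ}

/-- Splitting off the first row of a Gaussian matrix. -/
lemma measurePreserving_head_tail :
    MeasurePreserving (fun X : Fin (n + 1) → Fin p → ℝ => (X 0, fun j : Fin n => X j.succ))
      (gaussianMatrix (n + 1) p)
      ((Measure.pi fun _ : Fin p => gaussianReal 0 1).prod (gaussianMatrix n p)) :=
  measurePreserving_piFinSuccAbove
    (fun _ : Fin (n + 1) => Measure.pi fun _ : Fin p => gaussianReal 0 1) 0

lemma trace_one_sub_rowProj (A : Matrix (Fin n) (Fin p) ℝ) (h : IsUnit (A * A.transpose).det)
    {m : ℕ} (hm : n + m + 2 = p) : (1 - rowProj A).trace = (m + 2 : ℕ) := by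
  rw [Matrix.trace_sub, trace_rowProj A h, Matrix.trace_one, Fintype.card_fin, ← hm]
  push_cast
  ring

/-- A Gaussian matrix with `n + 2 ≤ p` has almost surely full row rank: a new row has almost surely
a positive distance from the span of the previous ones. -/
lemma ae_isUnit_gram : ∀ n : ℕ, n + 1 < p → ∀ᵐ X ∂(gaussianMatrix n p),
    IsUnit ((Matrix.of X) * (Matrix.of X).transpose).det
  | 0, _ => ae_of_all _ fun X => by simp
  | n + 1, hn => by
    -- The complement of the row space of the first `n` rows has dimension `m + 2`.
    obtain ⟨m, hm⟩ : ∃ m, n + m + 2 = p := ⟨p - n - 2, by omega⟩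
    have ih := ae_isUnit_gram n (by omega)
    have hprod : ∀ᵐ z ∂((Measure.pi fun _ : Fin p => gaussianReal 0 1).prod (gaussianMatrix n p)),
        IsUnit ((Matrix.of (Fin.cons z.1 z.2 : Fin (n + 1) → Fin p → ℝ)) *
          (Matrix.of (Fin.cons z.1 z.2 : Fin (n + 1) → Fin p → ℝ)).transpose).det := by
      have hmeas := measurable_cons (n := n) (p := p) measurableSet_isUnit_gram
      refine (Measure.ae_prod_iff_ae_ae hmeas).2 ((Measure.ae_ae_comm (p := fun x A =>
        IsUnit ((Matrix.of (Fin.cons x A : Fin (n + 1) → Fin p → ℝ)) *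
          (Matrix.of (Fin.cons x A : Fin (n + 1) → Fin p → ℝ)).transpose).det) hmeas).2 ?_)
      filter_upwards [ih] with A hA
      filter_upwards [ae_quadratic_ne_zero (by omega) (1 - rowProj (Matrix.of A))
        (one_sub_rowProj_transpose _) (one_sub_rowProj_mul_self _)
        (trace_one_sub_rowProj _ hA hm)] with x hx
      exact (gram_cons (Matrix.of A) x hA hx _ rfl fun _ => rfl).1
    filter_upwards [measurePreserving_head_tail.quasiMeasurePreserving.ae hprod] with X hX
    have : (Fin.cons (X 0) fun j : Fin n => X j.succ : Fin (n + 1) → Fin p → ℝ) = X :=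
      Fin.cons_self_tail X
    rwa [this] at hX

/-- The corner entry of `(X Xᵀ)⁻¹` is the inverse of a chi-square variable with `p - n + 1` degrees
of freedom, namely of the squared distance of the first row from the span of the others. -/
lemma lintegral_gram_inv_zero (hn : n + 1 + 1 < p) :
    ∫⁻ X, ENNReal.ofReal (((Matrix.of X) * (Matrix.of X).transpose)⁻¹ 0 0)
      ∂(gaussianMatrix (n + 1) p) = ENNReal.ofReal (1 / ((p : ℝ) - (n + 1) - 1)) := by
  obtain ⟨m, hm⟩ : ∃ m, n + m + 2 = p := ⟨p - n - 2, by omega⟩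
  have hmp : (p : ℝ) - (n + 1) - 1 = m := by rw [← hm]; push_cast; ring
  let f : (Fin p → ℝ) × (Fin n → Fin p → ℝ) → ENNReal := fun z =>
    ENNReal.ofReal (((Matrix.of (Fin.cons z.1 z.2 : Fin (n + 1) → Fin p → ℝ)) *
      (Matrix.of (Fin.cons z.1 z.2 : Fin (n + 1) → Fin p → ℝ)).transpose)⁻¹ 0 0)
  have hf : Measurable f := by
    have := (measurable_gram_inv_apply (n := n + 1) (p := p) 0 0).comp (measurable_cons)
    exact this.ennreal_ofReal
  have h1 := measurePreserving_head_tail.lintegral_comp hf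
  have h2 : ∀ X : Fin (n + 1) → Fin p → ℝ, f (X 0, fun j : Fin n => X j.succ)
      = ENNReal.ofReal (((Matrix.of X) * (Matrix.of X).transpose)⁻¹ 0 0) := fun X => by
    have : (Fin.cons (X 0) fun j : Fin n => X j.succ : Fin (n + 1) → Fin p → ℝ) = X :=
      Fin.cons_self_tail X
    simp only [f, this]
  simp_rw [h2] at h1
  rw [h1, lintegral_prod_symm' f hf, hmp]
  have h3 : ∀ᵐ A ∂(gaussianMatrix n p),
      ∫⁻ x, f (x, A) ∂(Measure.pi fun _ : Fin p => gaussianReal 0 1) = ENNReal.ofReal (1 / m) := by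
    filter_upwards [ae_isUnit_gram n (by omega)] with A hA
    have htr := trace_one_sub_rowProj _ hA hm
    have hs := one_sub_rowProj_transpose (Matrix.of A)
    have hi := one_sub_rowProj_mul_self (Matrix.of A)
    rw [← lintegral_inv_quadratic (by omega) _ hs hi htr]
    refine lintegral_congr_ae ?_
    filter_upwards [ae_quadratic_ne_zero (by omega) _ hs hi htr] with x hx
    have hpos := lt_of_le_of_ne (quadratic_nonneg _ hs hi x) hx.symm
    simp only [f]
    rw [(gram_cons (Matrix.of A) x hA hx _ rfl fun _ => rfl).2, ENNReal.ofReal_inv_of_pos hpos]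
  rw [lintegral_congr_ae h3]
  simp

lemma measurePreserving_comp_perm {ι α : Type*} [Fintype ι] [MeasurableSpace α] (ν : Measure α)
    [SigmaFinite ν] (e : Equiv.Perm ι) :
    MeasurePreserving (fun (x : ι → α) k => x (e k)) (Measure.pi fun _ => ν)
      (Measure.pi fun _ => ν) := by
  convert measurePreserving_piCongrLeft (fun _ : ι => ν) e.symm using 1
  funext x k
  have := Equiv.piCongrLeft_apply_apply (fun _ : ι => α) e.symm x (e k)
  rw [Equiv.symm_apply_apply] at this
  exact this.symm

lemma gram_inv_apply_self_nonneg (X : Matrix (Fin n) (Fin p) ℝ) (i : Fin n) :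
    0 ≤ (X * X.transpose)⁻¹ i i := by
  rw [← rightInv_transpose_mul_rightInv, Matrix.mul_apply]
  exact Finset.sum_nonneg fun k _ => mul_self_nonneg _

lemma lintegral_gram_inv_diag (hn : n + 1 < p) (i : Fin n) :
    ∫⁻ X, ENNReal.ofReal (((Matrix.of X) * (Matrix.of X).transpose)⁻¹ i i)
      ∂(gaussianMatrix n p) = ENNReal.ofReal (1 / ((p : ℝ) - n - 1)) := by
  obtain ⟨k, rfl⟩ : ∃ k, n = k + 1 := ⟨n - 1, by have := i.pos; omega⟩
  push_cast
  rw [← lintegral_gram_inv_zero hn]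
  have hmp : MeasurePreserving (fun (X : Fin (k + 1) → Fin p → ℝ) l => X (Equiv.swap 0 i l))
      (gaussianMatrix (k + 1) p) (gaussianMatrix (k + 1) p) :=
    measurePreserving_comp_perm _ _
  rw [← hmp.lintegral_comp (f := fun X =>
    ENNReal.ofReal (((Matrix.of X) * (Matrix.of X).transpose)⁻¹ 0 0))
    (measurable_gram_inv_apply (n := k + 1) (p := p) 0 0).ennreal_ofReal]
  refine lintegral_congr fun X => ?_
  have h : (Matrix.of fun l => X (Equiv.swap 0 i l)) *
      (Matrix.of fun l => X (Equiv.swap 0 i l)).transpose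
      = (Matrix.of X * (Matrix.of X).transpose).submatrix (Equiv.swap 0 i) (Equiv.swap 0 i) := rfl
  rw [h, Matrix.inv_submatrix_equiv]
  simp

/-- The mean of the diagonal of the inverse Wishart matrix `(X Xᵀ)⁻¹`. -/
lemma integrable_gram_inv_diag (hn : n + 1 < p) (i : Fin n) :
    Integrable (fun X => ((Matrix.of X) * (Matrix.of X).transpose)⁻¹ i i) (gaussianMatrix n p) ∧
    ∫ X, ((Matrix.of X) * (Matrix.of X).transpose)⁻¹ i i ∂(gaussianMatrix n p)
      = 1 / ((p : ℝ) - n - 1) := by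
  have hm : Measurable fun X : Fin n → Fin p → ℝ =>
    ((Matrix.of X) * (Matrix.of X).transpose)⁻¹ i i := measurable_gram_inv_apply i i
  have hnn : ∀ X : Fin n → Fin p → ℝ, 0 ≤ ((Matrix.of X) * (Matrix.of X).transpose)⁻¹ i i :=
    fun X => gram_inv_apply_self_nonneg _ i
  have hn' : (n : ℝ) + 1 < p := by exact_mod_cast hn
  constructor
  · refine ⟨hm.aestronglyMeasurable, ?_⟩
    rw [hasFiniteIntegral_iff_ofReal (ae_of_all _ hnn), lintegral_gram_inv_diag hn]
    exact ENNReal.ofReal_lt_top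
  · rw [integral_eq_lintegral_of_nonneg_ae (ae_of_all _ hnn) hm.aestronglyMeasurable,
      lintegral_gram_inv_diag hn, ENNReal.toReal_ofReal]
    exact one_div_nonneg.2 (by linarith)

end FullRank

/-! ### Mean of the projection onto the row space -/

section MeanProjection

variable {n p : ℕ}

lemma MeasureTheory.MeasurePreserving.integral_comp_measurable {α β : Type*} [MeasurableSpace α]
    [MeasurableSpace β] {μ : Measure α} {ν : Measure β} {g : α → β} (hg : MeasurePreserving g μ ν)
    {f : β → ℝ} (hf : Measurable f) : ∫ x, f (g x) ∂μ = ∫ y, f y ∂ν := by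
  rw [← hg.map_eq, integral_map hg.measurable.aemeasurable hf.aestronglyMeasurable]

lemma rowProj_submatrix (X : Matrix (Fin n) (Fin p) ℝ) (e : Equiv.Perm (Fin p)) :
    rowProj (X.submatrix id e) = (rowProj X).submatrix e e := by
  have h : X.submatrix id e * (X.submatrix id e).transpose = X * X.transpose := by
    rw [Matrix.transpose_submatrix, Matrix.submatrix_mul_equiv]
    rfl
  rw [rowProj, rightInv, h, rowProj, rightInv]
  rfl

lemma rowProj_mul_diagonal (X : Matrix (Fin n) (Fin p) ℝ) (d : Fin p → ℝ)
    (hd : ∀ j, d j * d j = 1) :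
    rowProj (X * Matrix.diagonal d) = Matrix.diagonal d * rowProj X * Matrix.diagonal d := by
  have hdd : Matrix.diagonal d * Matrix.diagonal d = 1 := by
    rw [Matrix.diagonal_mul_diagonal, ← Matrix.diagonal_one]
    exact congrArg _ (funext hd)
  have h : X * Matrix.diagonal d * (X * Matrix.diagonal d).transpose = X * X.transpose := by
    rw [Matrix.transpose_mul, Matrix.diagonal_transpose, Matrix.mul_assoc,
      ← Matrix.mul_assoc (Matrix.diagonal d), hdd, Matrix.one_mul]
  rw [rowProj, rightInv, h, rowProj, rightInv, Matrix.transpose_mul, Matrix.diagonal_transpose]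
  simp only [Matrix.mul_assoc]

lemma integrable_rowProj_apply (i j : Fin p) :
    Integrable (fun X => rowProj (Matrix.of X) i j) (gaussianMatrix n p) :=
  Integrable.of_bound (measurable_matrix_iff.1 measurable_rowProj i j).aestronglyMeasurable 2
    (ae_of_all _ fun X => abs_rowProj_apply_le (Matrix.of X) i j)

/-- `E P = (n / p) I`: sign changes of the columns kill the off-diagonal entries, permutations of
the columns make the diagonal constant, and the trace is `n`. -/
lemma integral_rowProj_apply (hn : n + 1 < p) (i j : Fin p) :
    ∫ X, rowProj (Matrix.of X) i j ∂(gaussianMatrix n p) = if i = j then (n : ℝ) / p else 0 := by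
  have hm : ∀ i j : Fin p, Measurable fun X : Fin n → Fin p → ℝ => rowProj (Matrix.of X) i j :=
    fun i j => measurable_matrix_iff.1 measurable_rowProj i j
  split_ifs with hij
  · subst hij
    have hdiag : ∀ k, ∫ X, rowProj (Matrix.of X) k k ∂(gaussianMatrix n p)
        = ∫ X, rowProj (Matrix.of X) i i ∂(gaussianMatrix n p) := by
      intro k
      have hmp : MeasurePreserving (fun (X : Fin n → Fin p → ℝ) a b => X a (Equiv.swap i k b))
          (gaussianMatrix n p) (gaussianMatrix n p) :=
        measurePreserving_pi _ _ fun _ => measurePreserving_comp_perm _ _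
      rw [← hmp.integral_comp_measurable (hm i i)]
      refine integral_congr_ae (ae_of_all _ fun X => ?_)
      have := rowProj_submatrix (Matrix.of X) (Equiv.swap i k)
      have h2 := congrFun (congrFun this i) i
      rw [Matrix.submatrix_apply, Equiv.swap_apply_left] at h2
      exact h2.symm
    have hsum : ∑ k, ∫ X, rowProj (Matrix.of X) k k ∂(gaussianMatrix n p) = n := by
      rw [← integral_finsetSum _ fun k _ => integrable_rowProj_apply k k]
      have : ∀ᵐ X ∂(gaussianMatrix n p), ∑ k, rowProj (Matrix.of X) k k = (n : ℝ) := by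
        filter_upwards [ae_isUnit_gram n hn] with X hX using trace_rowProj _ hX
      rw [integral_congr_ae this]
      simp
    simp_rw [hdiag] at hsum
    have hp : (p : ℝ) ≠ 0 := by have := i.pos; positivity
    rw [Finset.sum_const, Finset.card_univ, Fintype.card_fin, nsmul_eq_mul] at hsum
    rw [eq_div_iff hp, mul_comm, hsum]
  · let d : Fin p → ℝ := fun k => if k = j then -1 else 1
    have hflip : ∀ k, MeasurePreserving (fun x : ℝ => x * d k) (gaussianReal 0 1)
        (gaussianReal 0 1) := by
      intro k
      refine ⟨by fun_prop, ?_⟩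
      by_cases hk : k = j
      · have := gaussianReal_map_neg (μ := 0) (v := 1)
        simpa [d, hk] using this
      · simp [d, hk]
    have hmp : MeasurePreserving (fun (X : Fin n → Fin p → ℝ) a b => X a b * d b)
        (gaussianMatrix n p) (gaussianMatrix n p) :=
      measurePreserving_pi _ _ fun _ => measurePreserving_pi _ _ hflip
    have h1 := hmp.integral_comp_measurable (hm i j)
    have h2 : ∀ X : Fin n → Fin p → ℝ,
        rowProj (Matrix.of fun a b => X a b * d b) i j = -rowProj (Matrix.of X) i j := by
      intro X
      have h3 : (Matrix.of fun a b => X a b * d b) = Matrix.of X * Matrix.diagonal d := by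
        ext a b
        rw [Matrix.mul_diagonal]; rfl
      rw [h3, rowProj_mul_diagonal _ _ (fun k => by by_cases hk : k = j <;> simp [d, hk]),
        Matrix.mul_diagonal, Matrix.diagonal_mul]
      simp [d, hij]
    simp_rw [h2] at h1
    rw [integral_neg] at h1
    linarith

end MeanProjection

/-! ### Moments of independent vectors and matrices -/

section Moments

variable {Ω : Type*} [MeasurableSpace Ω] {μ : Measure Ω} {m n p : ℕ}

/-- If `A` is a random matrix with mean `c I`, independent of the random matrix `W`, then
`E ∑ A i j * W i j = c E tr W`. -/
lemma integral_sum_mul_of_indepFun {A W : Ω → Matrix (Fin m) (Fin m) ℝ} {c : ℝ}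
    (hind : IndepFun A W μ) (hA : ∀ i j, Integrable (fun ω => A ω i j) μ)
    (hW : ∀ i j, Integrable (fun ω => W ω i j) μ)
    (hmean : ∀ i j, ∫ ω, A ω i j ∂μ = if i = j then c else 0) :
    Integrable (fun ω => ∑ i, ∑ j, A ω i j * W ω i j) μ ∧
      ∫ ω, ∑ i, ∑ j, A ω i j * W ω i j ∂μ = c * ∑ i, ∫ ω, W ω i i ∂μ := by
  have hij : ∀ i j, IndepFun (fun ω => A ω i j) (fun ω => W ω i j) μ := fun i j =>
    hind.comp (measurable_matrix_apply i j) (measurable_matrix_apply i j)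
  have hint : ∀ i j, Integrable (fun ω => A ω i j * W ω i j) μ := fun i j =>
    (hij i j).integrable_mul (hA i j) (hW i j)
  refine ⟨integrable_finsetSum _ fun i _ => integrable_finsetSum _ fun j _ => hint i j, ?_⟩
  rw [integral_finsetSum _ fun i _ => integrable_finsetSum _ fun j _ => hint i j, Finset.mul_sum]
  refine Finset.sum_congr rfl fun i _ => ?_
  rw [integral_finsetSum _ fun j _ => hint i j]
  have : ∀ j, ∫ ω, A ω i j * W ω i j ∂μ = if i = j then c * ∫ ω, W ω i j ∂μ else 0 := by
    intro j
    rw [(hij i j).integral_fun_mul_eq_mul_integral (hA i j).aestronglyMeasurable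
      (hW i j).aestronglyMeasurable, hmean]
    split_ifs <;> simp
  simp_rw [this]
  simp

lemma dotProduct_mulVec_eq_sum (v w : Fin m → ℝ) (A : Matrix (Fin m) (Fin m) ℝ) :
    v ⬝ᵥ A.mulVec w = ∑ i, ∑ j, v i * w j * A i j := by
  simp only [dotProduct, Matrix.mulVec, Finset.mul_sum]
  exact Finset.sum_congr rfl fun i _ => Finset.sum_congr rfl fun j _ => by ring

/-- The entries of a random vector of square-integrable length have integrable products. -/
lemma integrable_mul_of_integrable_dotProduct {u : Ω → Fin m → ℝ} (hu : Measurable u)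
    (hint : Integrable (fun ω => u ω ⬝ᵥ u ω) μ) (i j : Fin m) :
    Integrable (fun ω => u ω i * u ω j) μ := by
  have hi : ∀ k, Measurable fun ω => u ω k := fun k => measurable_pi_iff.1 hu k
  refine hint.mono' ((hi i).mul (hi j)).aestronglyMeasurable (ae_of_all _ fun ω => ?_)
  have hle : ∀ k, u ω k * u ω k ≤ u ω ⬝ᵥ u ω := fun k =>
    Finset.single_le_sum (f := fun k => u ω k * u ω k) (fun l _ => mul_self_nonneg _)
      (Finset.mem_univ k)
  rw [Real.norm_eq_abs, abs_le]
  constructor <;> nlinarith [hle i, hle j, sq_nonneg (u ω i - u ω j), sq_nonneg (u ω i + u ω j)]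

lemma measurable_vecMulVec {u : Ω → Fin m → ℝ} (hu : Measurable u) :
    Measurable fun ω => Matrix.vecMulVec (u ω) (u ω) := by
  refine measurable_matrix_iff.2 fun i j => ?_
  simp only [Matrix.vecMulVec_apply]
  exact (measurable_pi_iff.1 hu i).mul (measurable_pi_iff.1 hu j)

/-- Out-of-sample loss: averaging over an independent instance with identity second moments turns
the squared prediction error into the squared length of the estimation error. -/
lemma integral_sq_dotProduct {x u : Ω → Fin m → ℝ} (hu : Measurable u)
    (hind : IndepFun x u μ) (hx2 : ∀ j, MemLp (fun ω => x ω j) 2 μ)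
    (hmom : ∀ i j, ∫ ω, x ω i * x ω j ∂μ = if i = j then 1 else 0)
    (hint : Integrable (fun ω => u ω ⬝ᵥ u ω) μ) :
    Integrable (fun ω => (x ω ⬝ᵥ u ω) ^ 2) μ ∧
      ∫ ω, (x ω ⬝ᵥ u ω) ^ 2 ∂μ = ∫ ω, u ω ⬝ᵥ u ω ∂μ := by
  have hvv : Measurable fun v : Fin m → ℝ => Matrix.vecMulVec v v :=
    measurable_vecMulVec measurable_id
  have hW := integrable_mul_of_integrable_dotProduct hu hint
  have h := integral_sum_mul_of_indepFun (A := fun ω => Matrix.vecMulVec (x ω) (x ω))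
    (W := fun ω => Matrix.vecMulVec (u ω) (u ω)) (c := 1) (hind.comp hvv hvv)
    (fun i j => (hx2 i).integrable_mul (hx2 j)) hW hmom
  have hsq : ∀ ω, (x ω ⬝ᵥ u ω) ^ 2 = ∑ i, ∑ j, Matrix.vecMulVec (x ω) (x ω) i j *
      Matrix.vecMulVec (u ω) (u ω) i j := fun ω => by
    rw [sq, dotProduct, Finset.sum_mul_sum]
    exact Finset.sum_congr rfl fun i _ => Finset.sum_congr rfl fun j _ => by
      simp only [Matrix.vecMulVec_apply]; ring
  simp_rw [hsq]
  refine ⟨h.1, h.2.trans ?_⟩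
  simp only [Matrix.vecMulVec_apply, one_mul, dotProduct]
  rw [integral_finsetSum _ fun i _ => hW i i]

lemma measurable_error {X : Ω → Matrix (Fin n) (Fin p) ℝ} {e : Ω → Fin n → ℝ}
    {u : Ω → Fin p → ℝ} (hX : Measurable X) (he : Measurable e) (hu : Measurable u) :
    Measurable fun ω => (1 - rowProj (X ω)).mulVec (u ω) + (rightInv (X ω)).mulVec (e ω) := by
  refine Measurable.add (measurable_mulVec (measurable_matrix_iff.2 fun i j => ?_) hu)
    (measurable_mulVec (measurable_rightInv.comp hX) he)
  exact measurable_const.sub ((measurable_matrix_iff.1 measurable_rowProj i j).comp hX)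

/-! ### Regression with a Gaussian design -/

/-- A regression sample with a standard Gaussian design `X` and an independent noise vector `e`
whose components are centred and uncorrelated with variance `s ^ 2`. -/
structure IsGaussianRegression (μ : Measure Ω) (X : Ω → Matrix (Fin n) (Fin p) ℝ)
    (e : Ω → Fin n → ℝ) (s : ℝ) : Prop where
  measurable_design : Measurable X
  measurable_noise : Measurable e
  law : μ.map (fun ω i j => X ω i j) = gaussianMatrix n p
  indep : IndepFun X e μ
  memLp : ∀ i, MemLp (fun ω => e ω i) 2 μ
  mean : ∀ i, ∫ ω, e ω i ∂μ = 0
  second_moment : ∀ i j, ∫ ω, e ω i * e ω j ∂μ = if i = j then s ^ 2 else 0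

namespace IsGaussianRegression

variable {X : Ω → Matrix (Fin n) (Fin p) ℝ} {e : Ω → Fin n → ℝ} {s : ℝ}

lemma measurePreserving (h : IsGaussianRegression μ X e s) :
    MeasurePreserving (fun ω i j => X ω i j) μ (gaussianMatrix n p) :=
  ⟨h.measurable_design, h.law⟩

lemma ae_isUnit (h : IsGaussianRegression μ X e s) (hn : n + 1 < p) :
    ∀ᵐ ω ∂μ, IsUnit (X ω * (X ω).transpose).det :=
  h.measurePreserving.quasiMeasurePreserving.ae (ae_isUnit_gram n hn)

lemma integrable_gram_inv_diag (h : IsGaussianRegression μ X e s) (hn : n + 1 < p) (i : Fin n) :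
    Integrable (fun ω => (X ω * (X ω).transpose)⁻¹ i i) μ ∧
      ∫ ω, (X ω * (X ω).transpose)⁻¹ i i ∂μ = 1 / ((p : ℝ) - n - 1) := by
  obtain ⟨h1, h2⟩ := _root_.integrable_gram_inv_diag hn i
  refine ⟨h.measurePreserving.integrable_comp_of_integrable h1, ?_⟩
  rw [← h2]
  exact h.measurePreserving.integral_comp_measurable (measurable_gram_inv_apply i i)

lemma integrable_gram_inv (h : IsGaussianRegression μ X e s) (hn : n + 1 < p) (i j : Fin n) :
    Integrable (fun ω => (X ω * (X ω).transpose)⁻¹ i j) μ := by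
  refine ((h.integrable_gram_inv_diag hn i).1.add (h.integrable_gram_inv_diag hn j).1).mono'
    ((measurable_gram_inv_apply i j).comp h.measurable_design).aestronglyMeasurable
    (ae_of_all _ fun ω => ?_)
  have := abs_transpose_mul_apply_le (rightInv (X ω)) i j
  rwa [rightInv_transpose_mul_rightInv] at this

lemma integrable_rightInv [IsFiniteMeasure μ] (h : IsGaussianRegression μ X e s)
    (hn : n + 1 < p) (k : Fin p) (i : Fin n) : Integrable (fun ω => rightInv (X ω) k i) μ := by
  refine ((integrable_const (1 : ℝ)).add (h.integrable_gram_inv_diag hn i).1).mono'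
    ((measurable_matrix_iff.1 measurable_rightInv k i).comp
      h.measurable_design).aestronglyMeasurable (ae_of_all _ fun ω => ?_)
  have := sq_le_transpose_mul_apply (rightInv (X ω)) k i
  rw [rightInv_transpose_mul_rightInv] at this
  simp only [Pi.add_apply, Real.norm_eq_abs, abs_le]
  constructor <;> nlinarith [sq_nonneg (rightInv (X ω) k i - 1), sq_nonneg (rightInv (X ω) k i + 1)]

lemma integrable_one_sub_rowProj [IsFiniteMeasure μ] (h : IsGaussianRegression μ X e s)
    (i j : Fin p) : Integrable (fun ω => (1 - rowProj (X ω)) i j) μ := by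
  simp only [Matrix.sub_apply]
  exact (integrable_const _).sub
    (h.measurePreserving.integrable_comp_of_integrable (integrable_rowProj_apply i j))

lemma integral_one_sub_rowProj [IsProbabilityMeasure μ] (h : IsGaussianRegression μ X e s)
    (hn : n + 1 < p) (i j : Fin p) :
    ∫ ω, (1 - rowProj (X ω)) i j ∂μ = if i = j then ((p : ℝ) - n) / p else 0 := by
  have hp : (p : ℝ) ≠ 0 := by have := i.pos; positivity
  have h1 : ∫ ω, rowProj (X ω) i j ∂μ = if i = j then (n : ℝ) / p else 0 := by
    rw [← integral_rowProj_apply hn]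
    exact h.measurePreserving.integral_comp_measurable
      (measurable_matrix_iff.1 measurable_rowProj i j)
  have h2 : Integrable (fun ω => rowProj (X ω) i j) μ :=
    h.measurePreserving.integrable_comp_of_integrable (integrable_rowProj_apply i j)
  simp only [Matrix.sub_apply]
  rw [integral_sub (integrable_const _) h2, h1, integral_const, Matrix.one_apply]
  split_ifs
  · simp only [probReal_univ, one_smul]
    field_simp
  · simp

/-- Noise contribution to the risk: `E eᵀ (X Xᵀ)⁻¹ e = s² n / (p - n - 1)`. -/
lemma integral_noise (h : IsGaussianRegression μ X e s) (hn : n + 1 < p) :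
    Integrable (fun ω => e ω ⬝ᵥ ((X ω * (X ω).transpose)⁻¹).mulVec (e ω)) μ ∧
      ∫ ω, e ω ⬝ᵥ ((X ω * (X ω).transpose)⁻¹).mulVec (e ω) ∂μ
        = s ^ 2 * n / ((p : ℝ) - n - 1) := by
  simp_rw [dotProduct_mulVec_eq_sum]
  have key := integral_sum_mul_of_indepFun (A := fun ω => Matrix.vecMulVec (e ω) (e ω))
    (W := fun ω => (X ω * (X ω).transpose)⁻¹) (c := s ^ 2)
    (h.indep.symm.comp (measurable_vecMulVec measurable_id) measurable_gram_inv)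
    (fun i j => (h.memLp i).integrable_mul (h.memLp j)) (h.integrable_gram_inv hn)
    h.second_moment
  refine ⟨key.1, key.2.trans ?_⟩
  simp_rw [(h.integrable_gram_inv_diag hn _).2]
  simp
  ring

/-- Contribution of an independent bias vector `u`: `E uᵀ (I - P) u = (1 - n / p) E ‖u‖²`. -/
lemma integral_bias [IsProbabilityMeasure μ] (h : IsGaussianRegression μ X e s) (hn : n + 1 < p)
    {u : Ω → Fin p → ℝ} (hu : Measurable u) (hind : IndepFun X u μ)
    (hint : Integrable (fun ω => u ω ⬝ᵥ u ω) μ) :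
    Integrable (fun ω => u ω ⬝ᵥ (1 - rowProj (X ω)).mulVec (u ω)) μ ∧
      ∫ ω, u ω ⬝ᵥ (1 - rowProj (X ω)).mulVec (u ω) ∂μ
        = ((p : ℝ) - n) / p * ∫ ω, u ω ⬝ᵥ u ω ∂μ := by
  have hW := integrable_mul_of_integrable_dotProduct hu hint
  have hR : Measurable fun Y : Matrix (Fin n) (Fin p) ℝ => 1 - rowProj Y :=
    measurable_matrix_iff.2 fun i j =>
      measurable_const.sub (measurable_matrix_iff.1 measurable_rowProj i j)
  have key := integral_sum_mul_of_indepFun (A := fun ω => 1 - rowProj (X ω))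
    (W := fun ω => Matrix.vecMulVec (u ω) (u ω)) (c := ((p : ℝ) - n) / p)
    (hind.comp hR (measurable_vecMulVec measurable_id))
    h.integrable_one_sub_rowProj hW (h.integral_one_sub_rowProj hn)
  have heq : ∀ ω, u ω ⬝ᵥ (1 - rowProj (X ω)).mulVec (u ω) = ∑ i, ∑ j, (1 - rowProj (X ω)) i j *
      Matrix.vecMulVec (u ω) (u ω) i j := fun ω => by
    rw [dotProduct_mulVec_eq_sum]
    simp only [Matrix.vecMulVec_apply, mul_comm]
  simp_rw [heq]
  refine ⟨key.1, key.2.trans ?_⟩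
  simp only [Matrix.vecMulVec_apply, dotProduct]
  rw [integral_finsetSum _ fun i _ => hW i i]

/-- Mean squared length of the error `(I - P) u + X⁺ e` of the interpolator closest to a centre
with error `u`. -/
lemma integral_error [IsProbabilityMeasure μ] (h : IsGaussianRegression μ X e s) (hn : n + 1 < p)
    {u : Ω → Fin p → ℝ} (hu : Measurable u) (hind : IndepFun X u μ)
    (hint : Integrable (fun ω => u ω ⬝ᵥ u ω) μ) :
    Integrable (fun ω => ((1 - rowProj (X ω)).mulVec (u ω) + (rightInv (X ω)).mulVec (e ω)) ⬝ᵥ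
      ((1 - rowProj (X ω)).mulVec (u ω) + (rightInv (X ω)).mulVec (e ω))) μ ∧
    ∫ ω, ((1 - rowProj (X ω)).mulVec (u ω) + (rightInv (X ω)).mulVec (e ω)) ⬝ᵥ
      ((1 - rowProj (X ω)).mulVec (u ω) + (rightInv (X ω)).mulVec (e ω)) ∂μ
      = ((p : ℝ) - n) / p * ∫ ω, u ω ⬝ᵥ u ω ∂μ + s ^ 2 * n / ((p : ℝ) - n - 1) := by
  simp_rw [dotProduct_self_proj_add]
  obtain ⟨h1, h2⟩ := h.integral_bias hn hu hind hint
  obtain ⟨h3, h4⟩ := h.integral_noise hn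
  exact ⟨h1.add h3, by rw [integral_add h1 h3, h2, h4]⟩

/-- Mean of the error `(I - P) v + X⁺ e` for a deterministic `v`. -/
lemma integral_error_apply [IsProbabilityMeasure μ] (h : IsGaussianRegression μ X e s)
    (hn : n + 1 < p) (v : Fin p → ℝ) (i : Fin p) :
    Integrable (fun ω => ((1 - rowProj (X ω)).mulVec v + (rightInv (X ω)).mulVec (e ω)) i) μ ∧
    ∫ ω, ((1 - rowProj (X ω)).mulVec v + (rightInv (X ω)).mulVec (e ω)) i ∂μ
      = ((p : ℝ) - n) / p * v i := by
  simp only [Pi.add_apply, Matrix.mulVec, dotProduct]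
  have h1 : ∀ j, Integrable (fun ω => (1 - rowProj (X ω)) i j * v j) μ := fun j =>
    (h.integrable_one_sub_rowProj i j).mul_const _
  have he : ∀ k, Integrable (fun ω => e ω k) μ := fun k => (h.memLp k).integrable one_le_two
  have hi : ∀ k, IndepFun (fun ω => rightInv (X ω) i k) (fun ω => e ω k) μ := fun k =>
    h.indep.comp (measurable_matrix_iff.1 measurable_rightInv i k) (measurable_pi_apply k)
  have h2 : ∀ k, Integrable (fun ω => rightInv (X ω) i k * e ω k) μ := fun k =>
    (hi k).integrable_mul (h.integrable_rightInv hn i k) (he k)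
  have h3 := integrable_finsetSum Finset.univ fun j _ => h1 j
  have h4 := integrable_finsetSum Finset.univ fun k _ => h2 k
  refine ⟨h3.add h4, ?_⟩
  rw [integral_add h3 h4, integral_finsetSum _ fun j _ => h1 j,
    integral_finsetSum _ fun k _ => h2 k]
  have h5 : ∀ k, ∫ ω, rightInv (X ω) i k * e ω k ∂μ = 0 := fun k => by
    rw [(hi k).integral_fun_mul_eq_mul_integral (h.integrable_rightInv hn i k).aestronglyMeasurable
      (he k).aestronglyMeasurable, h.mean, mul_zero]
  simp_rw [h5, integral_mul_const, h.integral_one_sub_rowProj hn]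
  simp

/-- Mean squared distance of the minimum-norm interpolator to a target `b - δ`, where `b` is the
coefficient vector of the sample; the error of the interpolator is `-(I - P) b + X⁺ e`. -/
lemma integral_shifted_error [IsProbabilityMeasure μ] (h : IsGaussianRegression μ X e s)
    (hn : n + 1 < p) (b δ : Fin p → ℝ) :
    Integrable (fun ω =>
      ((1 - rowProj (X ω)).mulVec (-b) + (rightInv (X ω)).mulVec (e ω) + δ) ⬝ᵥ
        ((1 - rowProj (X ω)).mulVec (-b) + (rightInv (X ω)).mulVec (e ω) + δ)) μ ∧
    ∫ ω, ((1 - rowProj (X ω)).mulVec (-b) + (rightInv (X ω)).mulVec (e ω) + δ) ⬝ᵥ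
        ((1 - rowProj (X ω)).mulVec (-b) + (rightInv (X ω)).mulVec (e ω) + δ) ∂μ
      = ((p : ℝ) - n) / p * (b - δ) ⬝ᵥ (b - δ) + (1 - ((p : ℝ) - n) / p) * δ ⬝ᵥ δ
        + s ^ 2 * n / ((p : ℝ) - n - 1) := by
  obtain ⟨h1, h2⟩ := h.integral_error hn (u := fun _ => -b) measurable_const
    (indepFun_const_right _ _) (integrable_const _)
  have h3 := h.integral_error_apply hn (-b)
  set D : Ω → Fin p → ℝ := fun ω =>
    (1 - rowProj (X ω)).mulVec (-b) + (rightInv (X ω)).mulVec (e ω)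
  have hexp : ∀ d : Fin p → ℝ,
      (d + δ) ⬝ᵥ (d + δ) = d ⬝ᵥ d + (∑ i, 2 * δ i * d i + δ ⬝ᵥ δ) := by
    intro d
    have : ∑ i, 2 * δ i * d i = 2 * (δ ⬝ᵥ d) := by
      rw [dotProduct, Finset.mul_sum]; exact Finset.sum_congr rfl fun i _ => by ring
    rw [this, add_dotProduct, dotProduct_add, dotProduct_add, dotProduct_comm d δ]
    ring
  have h4 : ∀ i, Integrable (fun ω => 2 * δ i * D ω i) μ := fun i => (h3 i).1.const_mul _
  have h5 := integrable_finsetSum Finset.univ fun i _ => h4 i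
  have h1' : Integrable (fun ω => D ω ⬝ᵥ D ω) μ := h1
  have h6 : Integrable (fun ω => ∑ i, 2 * δ i * D ω i + δ ⬝ᵥ δ) μ :=
    h5.add (integrable_const (μ := μ) (δ ⬝ᵥ δ))
  change Integrable (fun ω => (D ω + δ) ⬝ᵥ (D ω + δ)) μ ∧ ∫ ω, (D ω + δ) ⬝ᵥ (D ω + δ) ∂μ = _
  simp_rw [hexp]
  refine ⟨h1'.add h6, ?_⟩
  rw [integral_add h1' h6, integral_add h5 (integrable_const _),
    integral_finsetSum _ fun i _ => h4 i]
  have h7 : ∑ i, ∫ ω, 2 * δ i * D ω i ∂μ = -(2 * (((p : ℝ) - n) / p) * (δ ⬝ᵥ b)) := by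
    rw [dotProduct, Finset.mul_sum, ← Finset.sum_neg_distrib]
    refine Finset.sum_congr rfl fun i _ => ?_
    rw [integral_const_mul, (h3 i).2, Pi.neg_apply]
    ring
  rw [h7]
  change (∫ ω, D ω ⬝ᵥ D ω ∂μ) + _ = _
  rw [h2]
  simp only [integral_const, probReal_univ, one_smul, neg_dotProduct, dotProduct_neg, neg_neg,
    sub_dotProduct, dotProduct_sub]
  rw [dotProduct_comm b δ]
  ring

/-- Expected loss of the interpolator closest to a random centre `c` with error `u = c - b`. -/
lemma integral_excessLoss [IsProbabilityMeasure μ] (h : IsGaussianRegression μ X e s)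
    (hn : n + 1 < p) (b : EuclideanSpace ℝ (Fin p)) (c : Ω → EuclideanSpace ℝ (Fin p))
    {u : Ω → Fin p → ℝ} (hu : Measurable u) (hcu : ∀ᵐ ω ∂μ, (c ω).ofLp - b.ofLp = u ω)
    (hind : IndepFun X u μ) (hint : Integrable (fun ω => u ω ⬝ᵥ u ω) μ)
    {x₀ : Ω → Fin p → ℝ} (hx2 : ∀ j, MemLp (fun ω => x₀ ω j) 2 μ)
    (hmom : ∀ i j, ∫ ω, x₀ ω i * x₀ ω j ∂μ = if i = j then 1 else 0)
    (hxind : IndepFun x₀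
      (fun ω => (1 - rowProj (X ω)).mulVec (u ω) + (rightInv (X ω)).mulVec (e ω)) μ) :
    Integrable (excessLoss x₀ b
      fun ω => nearestInterpolator (X ω) (response (X ω) b (e ω)) (c ω)) μ ∧
    ∫ ω, excessLoss x₀ b
      (fun ω => nearestInterpolator (X ω) (response (X ω) b (e ω)) (c ω)) ω ∂μ
      = ((p : ℝ) - n) / p * ∫ ω, u ω ⬝ᵥ u ω ∂μ + s ^ 2 * n / ((p : ℝ) - n - 1) := by
  obtain ⟨h1, h2⟩ := h.integral_error hn hu hind hint
  obtain ⟨h3, h4⟩ := integral_sq_dotProduct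
    (measurable_error h.measurable_design h.measurable_noise hu) hxind hx2 hmom h1
  have hae : (fun ω => (x₀ ω ⬝ᵥ
      ((1 - rowProj (X ω)).mulVec (u ω) + (rightInv (X ω)).mulVec (e ω))) ^ 2) =ᵐ[μ]
      excessLoss x₀ b fun ω => nearestInterpolator (X ω) (response (X ω) b (e ω)) (c ω) := by
    filter_upwards [h.ae_isUnit hn, hcu] with ω hω hc
    rw [excessLoss, ← dotProduct_sub, nearestInterpolator_response_sub _ hω, hc]
  exact ⟨h3.congr hae, by rw [← integral_congr_ae hae, h4, h2]⟩

end IsGaussianRegression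

end Moments

/-! ### Risks in the isotropic Gaussian model -/

lemma measurable_design_iSup {Ω : Type*} {Q p : ℕ} {n : Fin (Q + 1) → ℕ}
    {X : (k : Fin (Q + 1)) → Ω → Matrix (Fin (n k)) (Fin p) ℝ}
    {ε : (k : Fin (Q + 1)) → Ω → Fin (n k) → ℝ}
    {S : Set (Fin (Q + 1) ⊕ Fin (Q + 1))} {k : Fin (Q + 1)}
    (hk : Sum.inl k ∈ S) :
    Measurable[⨆ i ∈ S, Sum.elim
      (fun k : Fin (Q + 1) => MeasurableSpace.comap (X k) inferInstance)
      (fun k : Fin (Q + 1) => MeasurableSpace.comap (ε k) inferInstance) i] (X k) := by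
  rw [measurable_iff_comap_le]
  exact le_iSup₂_of_le (Sum.inl k) hk le_rfl

lemma measurable_noise_iSup {Ω : Type*} {Q p : ℕ} {n : Fin (Q + 1) → ℕ}
    {X : (k : Fin (Q + 1)) → Ω → Matrix (Fin (n k)) (Fin p) ℝ}
    {ε : (k : Fin (Q + 1)) → Ω → Fin (n k) → ℝ}
    {S : Set (Fin (Q + 1) ⊕ Fin (Q + 1))} {k : Fin (Q + 1)}
    (hk : Sum.inr k ∈ S) :
    Measurable[⨆ i ∈ S, Sum.elim
      (fun k : Fin (Q + 1) => MeasurableSpace.comap (X k) inferInstance)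
      (fun k : Fin (Q + 1) => MeasurableSpace.comap (ε k) inferInstance) i] (ε k) := by
  rw [measurable_iff_comap_le]
  exact le_iSup₂_of_le (Sum.inr k) hk le_rfl

namespace IsIsotropicGaussianModel

variable {Ω : Type*} [MeasurableSpace Ω] {μ : Measure Ω} {Q p : ℕ} {q : Fin (Q + 1)}
  {n : Fin (Q + 1) → ℕ} {σ : Fin (Q + 1) → ℝ}
  {X : (k : Fin (Q + 1)) → Ω → Matrix (Fin (n k)) (Fin p) ℝ}
  {ε : (k : Fin (Q + 1)) → Ω → Fin (n k) → ℝ} {x₀ : Ω → Fin p → ℝ}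

/-- Random variables built from disjoint groups of designs and noise vectors are independent. -/
lemma indepFun_of_disjoint (h : IsIsotropicGaussianModel μ q n σ X ε x₀)
    {S T : Set (Fin (Q + 1) ⊕ Fin (Q + 1))} (hST : Disjoint S T)
    {α α' : Type*} [MeasurableSpace α] [MeasurableSpace α'] {f : Ω → α} {g : Ω → α'}
    (hf : Measurable[⨆ i ∈ S, Sum.elim
      (fun k : Fin (Q + 1) => MeasurableSpace.comap (X k) inferInstance)
      (fun k : Fin (Q + 1) => MeasurableSpace.comap (ε k) inferInstance) i] f)
    (hg : Measurable[⨆ i ∈ T, Sum.elim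
      (fun k : Fin (Q + 1) => MeasurableSpace.comap (X k) inferInstance)
      (fun k : Fin (Q + 1) => MeasurableSpace.comap (ε k) inferInstance) i] g) :
    IndepFun f g μ := by
  rw [IndepFun_iff_Indep]
  have hle : ∀ i, Sum.elim
      (fun k : Fin (Q + 1) => MeasurableSpace.comap (X k) inferInstance)
      (fun k : Fin (Q + 1) => MeasurableSpace.comap (ε k) inferInstance) i
      ≤ ‹MeasurableSpace Ω› := by
    rintro (k | k)
    · exact (h.measurable_design k).comap_le
    · exact (h.measurable_noise k).comap_le
  exact indep_of_indep_of_le_left (indep_of_indep_of_le_right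
    (indep_iSup_of_disjoint hle h.indep_design_noise hST) hg.comap_le) hf.comap_le

lemma law_design (h : IsIsotropicGaussianModel μ q n σ X ε x₀) {k : Fin (Q + 1)}
    (hk : k = 0 ∨ k = q) : μ.map (fun ω i j => X k ω i j) = gaussianMatrix (n k) p := by
  have hm : ∀ ij : Fin (n k) × Fin p, Measurable fun ω => X k ω ij.1 ij.2 := fun ij =>
    measurable_matrix_iff.1 (h.measurable_design k) ij.1 ij.2
  have h1 := (h.indep_entries k hk).map_fun_eq_pi_map fun ij => (hm ij).aemeasurable
  simp_rw [h.gaussian_entries k hk] at h1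
  have h2 := congrArg (Measure.map (MeasurableEquiv.curry (Fin (n k)) (Fin p) ℝ)) h1
  rw [Measure.map_map (MeasurableEquiv.measurable _) (measurable_pi_iff.2 hm),
    ← Measure.infinitePi_eq_pi, Measure.infinitePi_map_curry (fun _ _ => gaussianReal 0 1)] at h2
  simp only [Measure.infinitePi_eq_pi] at h2
  exact h2

lemma isGaussianRegression [IsProbabilityMeasure μ]
    (h : IsIsotropicGaussianModel μ q n σ X ε x₀) {k : Fin (Q + 1)}
    (hk : k = 0 ∨ k = q) : IsGaussianRegression μ (X k) (ε k) (σ k) where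
  measurable_design := h.measurable_design k
  measurable_noise := h.measurable_noise k
  law := h.law_design hk
  indep := h.indepFun_of_disjoint (S := {Sum.inl k}) (T := {Sum.inr k}) (by simp)
    (measurable_design_iSup rfl) (measurable_noise_iSup rfl)
  memLp := h.memLp_noise k
  mean := h.mean_noise k
  second_moment i j := by
    split_ifs with hij
    · subst hij
      rw [← h.variance_noise k i, variance_of_integral_eq_zero
        (h.memLp_noise k i).aestronglyMeasurable.aemeasurable (h.mean_noise k i)]
      exact integral_congr_ae (ae_of_all _ fun ω => (sq _).symm)
    · rw [((h.indep_noise k).indepFun hij).integral_fun_mul_eq_mul_integral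
        (h.memLp_noise k i).aestronglyMeasurable (h.memLp_noise k j).aestronglyMeasurable,
        h.mean_noise, zero_mul]

lemma expectedExcessRisk_eq_integral [IsProbabilityMeasure μ]
    (h : IsIsotropicGaussianModel μ q n σ X ε x₀) (b : EuclideanSpace ℝ (Fin p))
    (est : Ω → EuclideanSpace ℝ (Fin p)) :
    expectedExcessRisk μ X x₀ b est = ∫ ω, excessLoss x₀ b est ω ∂μ :=
  integral_condExp (iSup_le fun k => (h.measurable_design k).comap_le)

lemma integral_excessLoss_target [IsProbabilityMeasure μ]
    (h : IsIsotropicGaussianModel μ q n σ X ε x₀) (hn : n 0 + 1 < p)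
    (β : Fin (Q + 1) → EuclideanSpace ℝ (Fin p)) :
    Integrable (excessLoss x₀ (β 0) (targetEstimate X ε β)) μ ∧
    ∫ ω, excessLoss x₀ (β 0) (targetEstimate X ε β) ω ∂μ
      = ((p : ℝ) - n 0) / p * ‖β 0‖ ^ 2 + σ 0 ^ 2 * n 0 / ((p : ℝ) - n 0 - 1) := by
  have hF : Measurable fun d : ((k : Fin (Q + 1)) → Matrix (Fin (n k)) (Fin p) ℝ) ×
      ((k : Fin (Q + 1)) → Fin (n k) → ℝ) =>
      (1 - rowProj (d.1 0)).mulVec (-(β 0).ofLp) + (rightInv (d.1 0)).mulVec (d.2 0) :=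
    measurable_error ((measurable_pi_apply 0).comp measurable_fst)
      ((measurable_pi_apply 0).comp measurable_snd) measurable_const
  have key := (h.isGaussianRegression (Or.inl rfl)).integral_excessLoss hn (β 0) (fun _ => 0)
    (u := fun _ => -(β 0).ofLp) measurable_const (ae_of_all _ fun ω => by simp)
    (indepFun_const_right _ _) (integrable_const _) h.memLp_instance h.second_moment_instance
    (h.indep_instance.comp measurable_id hF)
  refine ⟨key.1, key.2.trans ?_⟩
  simp [EuclideanSpace.ofLp_dotProduct_self]

lemma integral_excessLoss_transfer [IsProbabilityMeasure μ]
    (h : IsIsotropicGaussianModel μ q n σ X ε x₀) (hq : q ≠ 0) (hn : n 0 + 1 < p)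
    (hnq : n q + 1 < p) (β : Fin (Q + 1) → EuclideanSpace ℝ (Fin p)) :
    Integrable (excessLoss x₀ (β 0) (transferEstimate X ε β q)) μ ∧
    ∫ ω, excessLoss x₀ (β 0) (transferEstimate X ε β q) ω ∂μ
      = ((p : ℝ) - n 0) / p * (((p : ℝ) - n q) / p * ‖β 0‖ ^ 2
          + (1 - ((p : ℝ) - n q) / p) * ‖β q - β 0‖ ^ 2
          + σ q ^ 2 * n q / ((p : ℝ) - n q - 1))
        + σ 0 ^ 2 * n 0 / ((p : ℝ) - n 0 - 1) := by
  have hreg := h.isGaussianRegression (Or.inr rfl)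
  let U : Matrix (Fin (n q)) (Fin p) ℝ × (Fin (n q) → ℝ) → Fin p → ℝ := fun z =>
    (1 - rowProj z.1).mulVec (-(β q).ofLp) + (rightInv z.1).mulVec z.2 + (β q - β 0).ofLp
  have hU : Measurable U :=
    (measurable_error measurable_fst measurable_snd measurable_const).add measurable_const
  have hF : Measurable fun d : ((k : Fin (Q + 1)) → Matrix (Fin (n k)) (Fin p) ℝ) ×
      ((k : Fin (Q + 1)) → Fin (n k) → ℝ) =>
      (1 - rowProj (d.1 0)).mulVec (U (d.1 q, d.2 q)) + (rightInv (d.1 0)).mulVec (d.2 0) :=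
    measurable_error ((measurable_pi_apply 0).comp measurable_fst)
      ((measurable_pi_apply 0).comp measurable_snd)
      (hU.comp (((measurable_pi_apply q).comp measurable_fst).prodMk
        ((measurable_pi_apply q).comp measurable_snd)))
  obtain ⟨h1, h2⟩ := hreg.integral_shifted_error hnq (β q).ofLp (β q - β 0).ofLp
  have hind : IndepFun (X 0) (fun ω => U (X q ω, ε q ω)) μ :=
    h.indepFun_of_disjoint (S := {Sum.inl 0}) (T := {Sum.inl q, Sum.inr q})
      (by simp [hq.symm]) (measurable_design_iSup rfl)
      (hU.comp ((measurable_design_iSup (by simp)).prodMk (measurable_noise_iSup (by simp))))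
  have hcu : ∀ᵐ ω ∂μ, (minNormInterpolator (X q ω) (response (X q ω) (β q) (ε q ω))).ofLp
      - (β 0).ofLp = U (X q ω, ε q ω) := by
    filter_upwards [hreg.ae_isUnit hnq] with ω hω
    have := nearestInterpolator_response_sub (X q ω) hω (β q) 0 (ε q ω)
    rw [WithLp.ofLp_zero, zero_sub] at this
    simp only [U, minNormInterpolator, ← this, WithLp.ofLp_sub]
    abel
  have key := (h.isGaussianRegression (Or.inl rfl)).integral_excessLoss hn (β 0) _
    (u := fun ω => U (X q ω, ε q ω))
    (hU.comp ((h.measurable_design q).prodMk (h.measurable_noise q))) hcu hind h1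
    h.memLp_instance h.second_moment_instance (h.indep_instance.comp measurable_id hF)
  refine ⟨key.1, key.2.trans ?_⟩
  have h3 : (β q).ofLp - (β q - β 0).ofLp = (β 0).ofLp := by simp
  rw [h3, EuclideanSpace.ofLp_dotProduct_self, EuclideanSpace.ofLp_dotProduct_self] at h2
  rw [← h2]

/-- Both risks contain the same target noise term; the difference compares the mean squared error
of the source interpolator, as an estimate of `β 0`, with that of the estimate `0`. -/
lemma expectedExcessRisk_sub [IsProbabilityMeasure μ]
    (h : IsIsotropicGaussianModel μ q n σ X ε x₀) (hq : q ≠ 0) (hn : n 0 + 1 < p)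
    (hnq : n q + 1 < p) (β : Fin (Q + 1) → EuclideanSpace ℝ (Fin p)) :
    expectedExcessRisk μ X x₀ (β 0) (targetEstimate X ε β)
        - expectedExcessRisk μ X x₀ (β 0) (transferEstimate X ε β q)
      = improvement (n 0) (β 0) (β q) (σ q) (n q) := by
  rw [h.expectedExcessRisk_eq_integral, h.expectedExcessRisk_eq_integral,
    (h.integral_excessLoss_target hn β).2, (h.integral_excessLoss_transfer hq hn hnq β).2,
    improvement, ← sub_sub (p : ℝ)]
  have hp : (p : ℝ) ≠ 0 := by have : 0 < p := by omega
                              positivity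
  have h1 : 1 - ((p : ℝ) - n q) / p = n q / p := by field_simp; ring
  have h2 : ((p : ℝ) - n q) / p = 1 - n q / p := by field_simp
  rw [h1, h2]
  ring

end IsIsotropicGaussianModel

/-! ### The improvement as a function of the transfer size -/

/-- Partial fractions: with `N = p - 1`, `x / (N - x) = N / (N - x) - 1`. The bound on `x` avoids
the pole. -/
lemma improvement_eq {p : ℕ} (n₀ : ℕ) (b₀ b₁ : EuclideanSpace ℝ (Fin p)) (s x : ℝ)
    (hx : x < p - 1) :
    improvement n₀ b₀ b₁ s x = ((p : ℝ) - n₀) / p * ((‖b₀‖ ^ 2 - ‖b₁ - b₀‖ ^ 2) / p * x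
      + s ^ 2 - s ^ 2 * (p - 1) / (p - 1 - x)) := by
  have h : (p : ℝ) - 1 - x ≠ 0 := by linarith
  have h' : (p : ℝ) - (x + 1) = p - 1 - x := by ring
  rw [improvement, h']
  congr 1
  field_simp
  ring

lemma hasDerivAt_improvement {p : ℕ} (n₀ : ℕ) (b₀ b₁ : EuclideanSpace ℝ (Fin p)) (s x : ℝ)
    (hx : x < p - 1) :
    HasDerivAt (improvement n₀ b₀ b₁ s)
      (((p : ℝ) - n₀) / p * ((‖b₀‖ ^ 2 - ‖b₁ - b₀‖ ^ 2) / p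
        - s ^ 2 * (p - 1) / (p - 1 - x) ^ 2)) x := by
  have h : (p : ℝ) - 1 - x ≠ 0 := by linarith
  have h1 : HasDerivAt (fun y : ℝ => (p : ℝ) - 1 - y) (-1) x := by
    simpa using (hasDerivAt_id x).const_sub ((p : ℝ) - 1)
  have h2 : HasDerivAt (fun y : ℝ => ((p : ℝ) - n₀) / p * ((‖b₀‖ ^ 2 - ‖b₁ - b₀‖ ^ 2) / p * y
      + s ^ 2 - s ^ 2 * (p - 1) / (p - 1 - y)))
      (((p : ℝ) - n₀) / p * ((‖b₀‖ ^ 2 - ‖b₁ - b₀‖ ^ 2) / p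
        - s ^ 2 * (p - 1) / (p - 1 - x) ^ 2)) x := by
    have h3 := (((hasDerivAt_id x).const_mul ((‖b₀‖ ^ 2 - ‖b₁ - b₀‖ ^ 2) / p)).add_const
      (s ^ 2)).sub ((hasDerivAt_const x (s ^ 2 * ((p : ℝ) - 1))).div h1 h)
    exact (h3.const_mul (((p : ℝ) - n₀) / p)).congr_deriv (by ring)
  refine h2.congr_of_eventuallyEq ?_
  filter_upwards [Iio_mem_nhds hx] with y hy using improvement_eq n₀ b₀ b₁ s y hy

lemma strictConcaveOn_improvement {p : ℕ} (hp : 3 ≤ p) (n₀ : ℕ) (hn₀ : n₀ + 1 < p)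
    (b₀ b₁ : EuclideanSpace ℝ (Fin p)) (s : ℝ) (hs : 0 < s) :
    StrictConcaveOn ℝ (Ico (1 : ℝ) (p - 1)) (improvement n₀ b₀ b₁ s) := by
  have hp' : (3 : ℝ) ≤ p := by exact_mod_cast hp
  have hn' : (n₀ : ℝ) + 1 < p := by exact_mod_cast hn₀
  have hC : 0 < ((p : ℝ) - n₀) / p := div_pos (by linarith) (by linarith)
  refine strictConcaveOn_of_slope_strict_anti_adjacent (convex_Ico _ _) ?_
  intro x y z hx hz hxy hyz
  have hy2 : y < (p : ℝ) - 1 := hyz.trans hz.2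
  rw [improvement_eq _ _ _ _ _ hx.2, improvement_eq _ _ _ _ _ hy2, improvement_eq _ _ _ _ _ hz.2]
  -- slopes of `x ↦ N / (N - x)` are `N / ((N - x) (N - y))`
  have key : ∀ u v : ℝ, u < v → v < (p : ℝ) - 1 →
      (((p : ℝ) - n₀) / p * ((‖b₀‖ ^ 2 - ‖b₁ - b₀‖ ^ 2) / p * v
        + s ^ 2 - s ^ 2 * (p - 1) / (p - 1 - v)) - ((p : ℝ) - n₀) / p *
        ((‖b₀‖ ^ 2 - ‖b₁ - b₀‖ ^ 2) / p * u + s ^ 2 - s ^ 2 * (p - 1) / (p - 1 - u))) / (v - u)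
      = ((p : ℝ) - n₀) / p * ((‖b₀‖ ^ 2 - ‖b₁ - b₀‖ ^ 2) / p
        - s ^ 2 * (p - 1) * ((p - 1 - u)⁻¹ * (p - 1 - v)⁻¹)) := by
    intro u v huv hv
    have h1 : (p : ℝ) - 1 - u ≠ 0 := by linarith
    have h2 : (p : ℝ) - 1 - v ≠ 0 := by linarith
    have h3 : v - u ≠ 0 := by linarith
    have h4 : (p : ℝ) ≠ 0 := by linarith
    field_simp
    ring
  rw [key x y hxy hy2, key y z hyz hz.2]
  have hi : ((p : ℝ) - 1 - x)⁻¹ < (p - 1 - z)⁻¹ :=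
    inv_strictAnti₀ (by linarith [hz.2]) (by linarith)
  have hpos : 0 < ((p : ℝ) - 1 - y)⁻¹ := inv_pos.2 (by linarith)
  have hsN : 0 < s ^ 2 * ((p : ℝ) - 1) := mul_pos (by positivity) (by linarith)
  refine mul_lt_mul_of_pos_left (sub_lt_sub_left (mul_lt_mul_of_pos_left ?_ hsN) _) hC
  rw [mul_comm ((p : ℝ) - 1 - y)⁻¹]
  exact mul_lt_mul_of_pos_right hi hpos

lemma signalToNoise_mul_eq {p : ℕ} {b₀ : EuclideanSpace ℝ (Fin p)} (hb : b₀ ≠ 0)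
    (b₁ : EuclideanSpace ℝ (Fin p)) (s : ℝ) :
    signalToNoise b₀ s * (1 - shiftToSignal b₀ b₁) = (‖b₀‖ ^ 2 - ‖b₁ - b₀‖ ^ 2) / s ^ 2 := by
  have h : ‖b₀‖ ^ 2 ≠ 0 := pow_ne_zero _ (norm_ne_zero_iff.2 hb)
  rw [signalToNoise, shiftToSignal]
  field_simp

lemma shiftToSignal_lt_one_iff {p : ℕ} {b₀ : EuclideanSpace ℝ (Fin p)} (hb : b₀ ≠ 0)
    (b₁ : EuclideanSpace ℝ (Fin p)) :
    shiftToSignal b₀ b₁ < 1 ↔ 0 < ‖b₀‖ ^ 2 - ‖b₁ - b₀‖ ^ 2 := by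
  have h : 0 < ‖b₀‖ ^ 2 := pow_pos (norm_pos_iff.2 hb) _
  rw [shiftToSignal, div_lt_one h, sub_pos]

lemma improvement_pos_iff {p : ℕ} (n₀ : ℕ) (hn₀ : n₀ + 1 < p)
    {b₀ : EuclideanSpace ℝ (Fin p)} (hb : b₀ ≠ 0) (b₁ : EuclideanSpace ℝ (Fin p)) (s : ℝ)
    (hs : 0 < s) (m : ℕ) (hm : 1 ≤ m) (hmp : m + 1 < p) :
    0 < improvement n₀ b₀ b₁ s m ↔ shiftToSignal b₀ b₁ < 1 ∧
      (p : ℝ) / (p - (m + 1)) < signalToNoise b₀ s * (1 - shiftToSignal b₀ b₁) := by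
  have hmp' : (m : ℝ) + 1 < p := by exact_mod_cast hmp
  have hn' : (n₀ : ℝ) + 1 < p := by exact_mod_cast hn₀
  have hm' : (0 : ℝ) < m := by exact_mod_cast hm
  have hp : (0 : ℝ) < p := by linarith
  have hC : 0 < ((p : ℝ) - n₀) / p := div_pos (by linarith) hp
  rw [signalToNoise_mul_eq hb, shiftToSignal_lt_one_iff hb, improvement, mul_pos_iff_of_pos_left hC,
    sub_pos]
  have hd : (0 : ℝ) < p - (m + 1) := by linarith
  set a := ‖b₀‖ ^ 2 - ‖b₁ - b₀‖ ^ 2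
  have h1 : s ^ 2 * m / (p - (m + 1)) < m / p * a ↔ (p : ℝ) / (p - (m + 1)) < a / s ^ 2 := by
    rw [div_lt_iff₀ hd, div_lt_div_iff₀ hd (by positivity)]
    have e1 : (m : ℝ) / p * a * (p - (m + 1)) = m / p * (a * (p - (m + 1))) := by ring
    have e2 : s ^ 2 * (m : ℝ) = m / p * (p * s ^ 2) := by field_simp
    rw [e1, e2, mul_lt_mul_iff_of_pos_left (div_pos hm' hp)]
  rw [h1]
  refine ⟨fun h => ⟨?_, h⟩, fun h => h.2⟩
  have : 0 < a / s ^ 2 := (div_pos hp hd).trans h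
  exact (div_pos_iff_of_pos_right (by positivity)).1 this

/-- The gap `d = p - 1 - n*` to the optimal size is positive and solves the first-order condition
`a d² = s² (p - 1)`, where `a = (‖b₀‖² - ‖b₁ - b₀‖²) / p`. -/
lemma optimalSize_spec {p : ℕ} (hp : 3 ≤ p)
    {b₀ : EuclideanSpace ℝ (Fin p)} (hb : b₀ ≠ 0) (b₁ : EuclideanSpace ℝ (Fin p)) (s : ℝ)
    (hs : 0 < s) (h : 0 < ‖b₀‖ ^ 2 - ‖b₁ - b₀‖ ^ 2) :
    optimalSize b₀ b₁ s < p - 1 ∧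
      (‖b₀‖ ^ 2 - ‖b₁ - b₀‖ ^ 2) / p * (p - 1 - optimalSize b₀ b₁ s) ^ 2 = s ^ 2 * (p - 1) := by
  have hp' : (3 : ℝ) ≤ p := by exact_mod_cast hp
  rw [optimalSize, signalToNoise_mul_eq hb]
  set a := ‖b₀‖ ^ 2 - ‖b₁ - b₀‖ ^ 2
  have hpos : 0 < (p : ℝ) * (p - 1) / (a / s ^ 2) :=
    div_pos (mul_pos (by linarith) (by linarith)) (by positivity)
  refine ⟨by linarith [Real.sqrt_pos.2 hpos], ?_⟩
  rw [sub_sub_cancel, Real.sq_sqrt hpos.le]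
  field_simp

/-- The parameter condition says that the optimal size does not lie to the left of `[1, p - 1)`. -/
lemma one_le_optimalSize_iff {p : ℕ} (hp : 3 ≤ p)
    {b₀ : EuclideanSpace ℝ (Fin p)} (hb : b₀ ≠ 0) (b₁ : EuclideanSpace ℝ (Fin p)) (s : ℝ)
    (hs : 0 < s) (h : 0 < ‖b₀‖ ^ 2 - ‖b₁ - b₀‖ ^ 2) :
    (p : ℝ) * (p - 1) / (p - 2) ^ 2 ≤ signalToNoise b₀ s * (1 - shiftToSignal b₀ b₁) ↔
      1 ≤ optimalSize b₀ b₁ s := by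
  have hp' : (3 : ℝ) ≤ p := by exact_mod_cast hp
  obtain ⟨h1, h2⟩ := optimalSize_spec hp hb b₁ s hs h
  rw [signalToNoise_mul_eq hb]
  set a := ‖b₀‖ ^ 2 - ‖b₁ - b₀‖ ^ 2
  set d := (p : ℝ) - 1 - optimalSize b₀ b₁ s with hd
  have hd0 : 0 < d := by linarith
  have h3 : 1 ≤ optimalSize b₀ b₁ s ↔ d ≤ p - 2 := by constructor <;> intro _ <;> linarith
  have h4 : d ≤ (p : ℝ) - 2 ↔ d ^ 2 ≤ ((p : ℝ) - 2) ^ 2 :=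
    (pow_le_pow_iff_left₀ hd0.le (by linarith) two_ne_zero).symm
  have h5 : a * d ^ 2 = s ^ 2 * (p * (p - 1)) := by
    field_simp at h2
    linarith
  rw [h3, h4, div_le_div_iff₀ (by nlinarith) (by positivity),
    ← mul_le_mul_iff_of_pos_left h (b := d ^ 2), h5]
  constructor <;> intro _ <;> linarith

/-- By the first-order condition, `Δ(n*) - Δ(x)` is a multiple of the square `(x - n*)²`. -/
lemma isMaxOn_optimalSize {p : ℕ} (hp : 3 ≤ p) (n₀ : ℕ) (hn₀ : n₀ + 1 < p)
    {b₀ : EuclideanSpace ℝ (Fin p)} (hb : b₀ ≠ 0) (b₁ : EuclideanSpace ℝ (Fin p)) (s : ℝ)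
    (hs : 0 < s) (h : 0 < ‖b₀‖ ^ 2 - ‖b₁ - b₀‖ ^ 2) :
    IsMaxOn (improvement n₀ b₀ b₁ s) (Ico (1 : ℝ) (p - 1)) (optimalSize b₀ b₁ s) := by
  intro x hx
  have hp' : (3 : ℝ) ≤ p := by exact_mod_cast hp
  have hn' : (n₀ : ℝ) + 1 < p := by exact_mod_cast hn₀
  have hC : 0 ≤ ((p : ℝ) - n₀) / p := div_nonneg (by linarith) (by linarith)
  obtain ⟨h1, h2⟩ := optimalSize_spec hp hb b₁ s hs h
  change improvement n₀ b₀ b₁ s x ≤ improvement n₀ b₀ b₁ s (optimalSize b₀ b₁ s)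
  rw [improvement_eq _ _ _ _ _ hx.2, improvement_eq _ _ _ _ _ h1]
  set a := (‖b₀‖ ^ 2 - ‖b₁ - b₀‖ ^ 2) / p
  have hd0 : 0 < (p : ℝ) - 1 - optimalSize b₀ b₁ s := by linarith
  have ht : 0 < (p : ℝ) - 1 - x := by linarith [hx.2]
  have ha : 0 < a := div_pos h (by linarith)
  refine mul_le_mul_of_nonneg_left ?_ hC
  rw [← sub_nonneg, ← h2]
  have : a * optimalSize b₀ b₁ s + s ^ 2 -
      a * (p - 1 - optimalSize b₀ b₁ s) ^ 2 / (p - 1 - optimalSize b₀ b₁ s) -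
      (a * x + s ^ 2 - a * (p - 1 - optimalSize b₀ b₁ s) ^ 2 / (p - 1 - x))
      = a * (x - optimalSize b₀ b₁ s) ^ 2 / (p - 1 - x) := by
    field_simp
    ring
  rw [this]
  positivity

lemma hasDerivAt_optimalSize {p : ℕ} (hp : 3 ≤ p) (n₀ : ℕ)
    {b₀ : EuclideanSpace ℝ (Fin p)} (hb : b₀ ≠ 0) (b₁ : EuclideanSpace ℝ (Fin p)) (s : ℝ)
    (hs : 0 < s) (h : 0 < ‖b₀‖ ^ 2 - ‖b₁ - b₀‖ ^ 2) :
    HasDerivAt (improvement n₀ b₀ b₁ s) 0 (optimalSize b₀ b₁ s) := by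
  obtain ⟨h1, h2⟩ := optimalSize_spec hp hb b₁ s hs h
  have hd0 : 0 < (p : ℝ) - 1 - optimalSize b₀ b₁ s := by linarith
  convert hasDerivAt_improvement n₀ b₀ b₁ s _ h1 using 1
  rw [← h2, mul_div_assoc, div_self (by positivity)]
  ring

lemma improvement_optimalSize {p : ℕ} (hp : 3 ≤ p) (n₀ : ℕ)
    {b₀ : EuclideanSpace ℝ (Fin p)} (hb : b₀ ≠ 0) (b₁ : EuclideanSpace ℝ (Fin p)) (s : ℝ)
    (hs : 0 < s) (h : 0 < ‖b₀‖ ^ 2 - ‖b₁ - b₀‖ ^ 2) :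
    improvement n₀ b₀ b₁ s (optimalSize b₀ b₁ s)
      = ((p : ℝ) - n₀) / p * (optimalSize b₀ b₁ s ^ 2 * (1 - shiftToSignal b₀ b₁)
          / (p * (p - 1))) * ‖b₀‖ ^ 2 := by
  have hp' : (3 : ℝ) ≤ p := by exact_mod_cast hp
  obtain ⟨h1, h2⟩ := optimalSize_spec hp hb b₁ s hs h
  have hb2 : ‖b₀‖ ^ 2 ≠ 0 := pow_ne_zero _ (norm_ne_zero_iff.2 hb)
  rw [improvement_eq _ _ _ _ _ h1, shiftToSignal, mul_assoc]
  congr 1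
  have h3 : optimalSize b₀ b₁ s ^ 2 * (1 - ‖b₁ - b₀‖ ^ 2 / ‖b₀‖ ^ 2) / (p * (p - 1)) * ‖b₀‖ ^ 2
      = optimalSize b₀ b₁ s ^ 2 / (p - 1) * ((‖b₀‖ ^ 2 - ‖b₁ - b₀‖ ^ 2) / p) := by
    field_simp
  rw [h3]
  set a := (‖b₀‖ ^ 2 - ‖b₁ - b₀‖ ^ 2) / p
  have hd0 : 0 < (p : ℝ) - 1 - optimalSize b₀ b₁ s := by linarith
  have hN : (p : ℝ) - 1 ≠ 0 := by linarith
  have hs2 : s ^ 2 = a * (p - 1 - optimalSize b₀ b₁ s) ^ 2 / (p - 1) := by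
    rw [h2]; field_simp
  rw [hs2]
  field_simp
  ring

/-- A stationary point in `[1, p - 1)` forces the parameter condition. -/
lemma condition_of_hasDerivAt_zero {p : ℕ} (hp : 3 ≤ p) (n₀ : ℕ)
    {b₀ : EuclideanSpace ℝ (Fin p)} (hb : b₀ ≠ 0) (b₁ : EuclideanSpace ℝ (Fin p)) (s : ℝ)
    (hs : 0 < s) (hn₀ : n₀ + 1 < p) {x : ℝ} (hx : x ∈ Ico (1 : ℝ) (p - 1))
    (hd : HasDerivAt (improvement n₀ b₀ b₁ s) 0 x) :
    shiftToSignal b₀ b₁ < 1 ∧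
      (p : ℝ) * (p - 1) / (p - 2) ^ 2 ≤ signalToNoise b₀ s * (1 - shiftToSignal b₀ b₁) := by
  have hp' : (3 : ℝ) ≤ p := by exact_mod_cast hp
  have hn' : (n₀ : ℝ) + 1 < p := by exact_mod_cast hn₀
  have hC : ((p : ℝ) - n₀) / p ≠ 0 := (div_pos (by linarith) (by linarith)).ne'
  have h1 := (hasDerivAt_improvement n₀ b₀ b₁ s x hx.2).unique hd
  have h2 := (mul_eq_zero.1 h1).resolve_left hC
  have ht : 0 < (p : ℝ) - 1 - x := by linarith [hx.2]
  rw [shiftToSignal_lt_one_iff hb, signalToNoise_mul_eq hb]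
  set a := ‖b₀‖ ^ 2 - ‖b₁ - b₀‖ ^ 2
  have h3 : a * (p - 1 - x) ^ 2 = s ^ 2 * (p * (p - 1)) := by
    rw [sub_eq_zero, div_eq_div_iff (by linarith) (by positivity)] at h2
    linarith
  have hr : 0 < s ^ 2 * ((p : ℝ) * (p - 1)) :=
    mul_pos (by positivity) (mul_pos (by linarith) (by linarith))
  have ha : 0 < a := by
    rw [← h3] at hr
    exact pos_of_mul_pos_left hr (by positivity)
  refine ⟨ha, ?_⟩
  rw [div_le_div_iff₀ (by nlinarith) (by positivity)]
  have : (p - 1 - x) ^ 2 ≤ ((p : ℝ) - 2) ^ 2 := by nlinarith [hx.1]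
  nlinarith

theorem corollary1 {Q p : ℕ} (q : Fin (Q + 1)) (hq : q ≠ 0) (n₀ : ℕ)
    (hp : 3 ≤ p) (hn₀ : n₀ + 1 < p)
    (β : Fin (Q + 1) → EuclideanSpace ℝ (Fin p)) (hβ : β 0 ≠ 0)
    (σ : Fin (Q + 1) → ℝ) (hσ : ∀ k, 0 < σ k) :
    -- for every source sample size and every model: the risks are well defined, their difference
    -- is the improvement function, and the criterion for positive transfer
    (∀ (n : Fin (Q + 1) → ℕ), n 0 = n₀ → 1 ≤ n q → n q + 1 < p →
      ∀ {Ω : Type*} [MeasurableSpace Ω] (μ : Measure Ω) [IsProbabilityMeasure μ]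
        (X : (k : Fin (Q + 1)) → Ω → Matrix (Fin (n k)) (Fin p) ℝ)
        (ε : (k : Fin (Q + 1)) → Ω → Fin (n k) → ℝ) (x₀ : Ω → Fin p → ℝ),
        IsIsotropicGaussianModel μ q n σ X ε x₀ →
        Integrable (excessLoss x₀ (β 0) (targetEstimate X ε β)) μ ∧
        Integrable (excessLoss x₀ (β 0) (transferEstimate X ε β q)) μ ∧
        expectedExcessRisk μ X x₀ (β 0) (targetEstimate X ε β)
            - expectedExcessRisk μ X x₀ (β 0) (transferEstimate X ε β q)
          = improvement n₀ (β 0) (β q) (σ q) (n q) ∧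
        (expectedExcessRisk μ X x₀ (β 0) (transferEstimate X ε β q)
            < expectedExcessRisk μ X x₀ (β 0) (targetEstimate X ε β) ↔
          shiftToSignal (β 0) (β q) < 1 ∧
          (p : ℝ) / (p - (n q + 1))
            < signalToNoise (β 0) (σ q) * (1 - shiftToSignal (β 0) (β q)))) ∧
    -- strict concavity
    StrictConcaveOn ℝ (Ico (1 : ℝ) (p - 1)) (improvement n₀ (β 0) (β q) (σ q)) ∧
    -- the optimal size exists and equals the stated value exactly under the stated condition
    (shiftToSignal (β 0) (β q) < 1 ∧
        (p : ℝ) * (p - 1) / (p - 2) ^ 2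
          ≤ signalToNoise (β 0) (σ q) * (1 - shiftToSignal (β 0) (β q)) ↔
      ∃ x ∈ Ico (1 : ℝ) (p - 1),
        IsMaxOn (improvement n₀ (β 0) (β q) (σ q)) (Ico (1 : ℝ) (p - 1)) x ∧
        x = optimalSize (β 0) (β q) (σ q)) ∧
    -- equivalently, exactly when some maximizer satisfies the first-order condition
    (shiftToSignal (β 0) (β q) < 1 ∧
        (p : ℝ) * (p - 1) / (p - 2) ^ 2
          ≤ signalToNoise (β 0) (σ q) * (1 - shiftToSignal (β 0) (β q)) ↔
      ∃ x ∈ Ico (1 : ℝ) (p - 1),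
        IsMaxOn (improvement n₀ (β 0) (β q) (σ q)) (Ico (1 : ℝ) (p - 1)) x ∧
        HasDerivAt (improvement n₀ (β 0) (β q) (σ q)) 0 x) ∧
    -- in that case the maximizer is unique and the maximal improvement is explicit and positive
    (shiftToSignal (β 0) (β q) < 1 →
      (p : ℝ) * (p - 1) / (p - 2) ^ 2
          ≤ signalToNoise (β 0) (σ q) * (1 - shiftToSignal (β 0) (β q)) →
      (∀ x ∈ Ico (1 : ℝ) (p - 1),
        IsMaxOn (improvement n₀ (β 0) (β q) (σ q)) (Ico (1 : ℝ) (p - 1)) x ↔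
          x = optimalSize (β 0) (β q) (σ q)) ∧
      improvement n₀ (β 0) (β q) (σ q) (optimalSize (β 0) (β q) (σ q))
        = ((p : ℝ) - n₀) / p
          * (optimalSize (β 0) (β q) (σ q) ^ 2 * (1 - shiftToSignal (β 0) (β q))
              / (p * (p - 1)))
          * ‖β 0‖ ^ 2 ∧
      0 < improvement n₀ (β 0) (β q) (σ q) (optimalSize (β 0) (β q) (σ q))) := by
  refine ⟨?_, strictConcaveOn_improvement hp n₀ hn₀ _ _ _ (hσ q), ?_, ?_, ?_⟩
  · intro n hn hnq hnqp Ω _ μ _ X ε x₀ h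
    subst hn
    have hsub := h.expectedExcessRisk_sub hq hn₀ hnqp β
    refine ⟨(h.integral_excessLoss_target hn₀ β).1,
      (h.integral_excessLoss_transfer hq hn₀ hnqp β).1, hsub, ?_⟩
    rw [← improvement_pos_iff (n 0) hn₀ hβ (β q) (σ q) (hσ q) (n q) hnq hnqp, ← hsub, sub_pos]
  · constructor
    · rintro ⟨h1, h2⟩
      have h := (shiftToSignal_lt_one_iff hβ (β q)).1 h1
      exact ⟨_, ⟨(one_le_optimalSize_iff hp hβ _ _ (hσ q) h).1 h2,
        (optimalSize_spec hp hβ _ _ (hσ q) h).1⟩,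
        isMaxOn_optimalSize hp n₀ hn₀ hβ _ _ (hσ q) h, rfl⟩
    · rintro ⟨x, hx, -, rfl⟩
      -- Under `1 ≤ SSR` the square root takes the junk value `0`, and `n* = p - 1` is excluded.
      have h : 0 < ‖β 0‖ ^ 2 - ‖β q - β 0‖ ^ 2 := by
        by_contra hle
        have hp' : (3 : ℝ) ≤ p := by exact_mod_cast hp
        have h0 : √((p : ℝ) * (p - 1) /
            (signalToNoise (β 0) (σ q) * (1 - shiftToSignal (β 0) (β q)))) = 0 := by
          rw [signalToNoise_mul_eq hβ]
          exact Real.sqrt_eq_zero_of_nonpos (div_nonpos_of_nonneg_of_nonpos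
            (mul_nonneg (by linarith) (by linarith))
            (div_nonpos_of_nonpos_of_nonneg (not_lt.1 hle) (sq_nonneg _)))
        have := hx.2
        rw [optimalSize, h0, sub_zero] at this
        exact lt_irrefl _ this
      exact ⟨(shiftToSignal_lt_one_iff hβ _).2 h,
        (one_le_optimalSize_iff hp hβ _ _ (hσ q) h).2 hx.1⟩
  · constructor
    · rintro ⟨h1, h2⟩
      have h := (shiftToSignal_lt_one_iff hβ (β q)).1 h1
      exact ⟨_, ⟨(one_le_optimalSize_iff hp hβ _ _ (hσ q) h).1 h2,
        (optimalSize_spec hp hβ _ _ (hσ q) h).1⟩,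
        isMaxOn_optimalSize hp n₀ hn₀ hβ _ _ (hσ q) h,
        hasDerivAt_optimalSize hp n₀ hβ _ _ (hσ q) h⟩
    · rintro ⟨x, hx, -, hd⟩
      exact condition_of_hasDerivAt_zero hp n₀ hβ _ _ (hσ q) hn₀ hx hd
  · intro h1 h2
    have h := (shiftToSignal_lt_one_iff hβ (β q)).1 h1
    have hopt : 1 ≤ optimalSize (β 0) (β q) (σ q) :=
      (one_le_optimalSize_iff hp hβ _ _ (hσ q) h).1 h2
    have hmem : optimalSize (β 0) (β q) (σ q) ∈ Ico (1 : ℝ) (p - 1) :=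
      ⟨hopt, (optimalSize_spec hp hβ _ _ (hσ q) h).1⟩
    have hmax := isMaxOn_optimalSize hp n₀ hn₀ hβ _ _ (hσ q) h
    have hval := improvement_optimalSize hp n₀ hβ (β q) _ (hσ q) h
    refine ⟨fun x hx => ⟨fun hxm => ?_, fun hxe => hxe ▸ hmax⟩, hval, ?_⟩
    · exact (strictConcaveOn_improvement hp n₀ hn₀ _ _ _ (hσ q)).eq_of_isMaxOn hxm hmax hx hmem
    · have hp' : (3 : ℝ) ≤ p := by exact_mod_cast hp
      have hn' : (n₀ : ℝ) + 1 < p := by exact_mod_cast hn₀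
      rw [hval]
      refine mul_pos (mul_pos (div_pos (by linarith) (by linarith)) (div_pos (mul_pos
        (by positivity) (by linarith)) (mul_pos (by linarith) (by linarith)))) ?_
      exact pow_pos (norm_pos_iff.2 hβ) 2
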